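/- Let $\Gamma$ be a distance-regular graph with finite vertex set $X$, path-length distance $\partial$, diameter $D\ge 3$ and valency at least $3$. Let $A_i$ be the $i$th distance matrix, $A=A_1$ the adjacency matrix and $M=\mathrm{Span}(A_0,\dots,A_D)\subseteq \mathrm{Mat}_X(\mathbb C)$ the Bose-Mesner algebra. Let $E_0=|X|^{-1}J,E_1,\dots,E_D$ be an ordering of the primitive idempotents of $M$ (a basis of $M$ with $E_iE_j=\delta_{ij}E_i$, $\sum_i E_i=I$) with respect to which $\Gamma$ is $Q$-polynomial: if $E_i\circ E_j=|X|^{-1}\sum_h q^h_{ij}E_h$, where $\circ$ is the entrywise product, then $q^h_{ij}=0$ (resp. $q^h_{ij}\ne 0$) whenever one of $h,i,j$ is greater than (resp. equal to) the sum of the other two. Fix $x\in X$. Let $E^*_i$ be the diagonal matrix with $(y,y)$-entry $1$ if $\partial(x,y)=i$ and $0$ otherwise, and $A^*$ the diagonal matrix with $(y,y)$-entry $|X|(E_1)_{xy}$. Write $A=\sum_{i=0}^D\theta_iE_i$ and $A^*=\sum_{i=0}^D\theta^*_iE^*_i$. Let $T$ be the subalgebra of $\mathrm{Mat}_X(\mathbb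 C)$ generated by $M$ and $E^*_0,\dots,E^*_D$. Let $W\subseteq\mathbb C^X$ be an irreducible $T$-module that is thin ($\dim E^*_iW\le 1$ for all $i$). Let $r=\min\{i: E^*_iW\neq0\}$ be its endpoint, $t=\min\{i:E_iW\ne 0\}$ its dual endpoint and $d=|\{i:E^*_iW\neq0\}|-1$ its diameter, and assume $d\ge1$. For nonzero $u\in E_tW$ (resp. nonzero $v\in E^*_rW$) the vectors $E^*_{r+i}u$ (resp. $E_{t+i}v$), $0\le i\le d$, form a basis of $W$; let $A^\flat$ (resp. $A^{*\sharp}$) be the matrix that represents $A$ (resp. $A^*$) on $W$ with respect to it. These matrices do not depend on the choice of $u$ and $v$. The intersection numbers and dual intersection numbers of $W$ considered here are $b_i(W)=(A^\flat)_{i,i+1}$, $b^*_i(W)=(A^{*\sharp})_{i,i+1}$ for $0\le i\le d-1$ and $c_i(W)=(A^\flat)_{i,i-1}$, $c_i^*(W)=(A^{*\sharp})_{i,i-1}$ for $1\le i\le d$. Let $\varphi_1$ be the eigenvalue of $(A-\theta_tI)(A^*-\theta^*_{r+1}I)$ on the one-dimensional space $(A-\theta_tI)E^*_rW$. Then $$b_0(W)=\frac{\varphi_1}{\theta^*_{r+1}-\theta^*_r},\qquad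 c_d(W)=\frac{\varphi_1+(\theta_{t+1}-\theta_t)(\theta^*_{r+d}-\theta^*_r)}{\theta^*_{r+d-1}-\theta^*_{r+d}},$$ and, if $d\ge2$, for $1\le i\le d-1$, $$b_i(W)=\frac{\varphi_1f_i^++g_i^+}{(\theta^*_{r+i+1}-\theta^*_{r+i})(\theta^*_{r+i+1}-\theta^*_{r+i-1})},\qquad c_i(W)=\frac{\varphi_1f_i^-+g_i^-}{(\theta^*_{r+i-1}-\theta^*_{r+i})(\theta^*_{r+i-1}-\theta^*_{r+i+1})},$$ where $$f_i^{\pm}=\theta^*_{r+1}-\theta^*_{r+i\mp1}-\frac{(\theta^*_{r+i}-\theta^*_r)(\theta^*_{r+1}-\theta^*_{r+d-1})}{\theta^*_{r+d}-\theta^*_r},$$ $$g_i^\pm=(\theta^*_{r+i}-\theta^*_r)\bigl((\theta_{t+2}-\theta_{t+1})(\theta^*_{r+i}-\theta^*_{r+d})-(\theta_{t+1}-\theta_t)(\theta^*_{r+i\mp1}-\theta^*_{r+d-1})\bigr).$$ Moreover $b^*_i(W)$ and $c^*_i(W)$ are given by the same formulas with $(\theta_{t+j},\theta^*_{r+j})$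 replaced by $(\theta^*_{r+j},\theta_{t+j})$ for all $j$ and $\varphi_1$ unchanged. -/

import Mathlib

open scoped Matrix

noncomputable section

namespace Terwilliger

variable {X : Type*}

/-- A connected graph is distance-regular when the number of vertices at distance `i` from `y` and
`j` from `z` depends only on `i`, `j` and the distance between `y` and `z`. -/
def IsDistanceRegular (Γ : SimpleGraph X) : Prop :=
  Γ.Connected ∧ ∃ p : ℕ → ℕ → ℕ → ℕ, ∀ (y z : X) (i j : ℕ),
    {w : X | Γ.dist y w = i ∧ Γ.dist z w = j}.ncard = p (Γ.dist y z) i j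

/-- The `i`th distance matrix `A_i`. -/
def distMatrix (Γ : SimpleGraph X) (i : ℕ) : Matrix X X ℂ :=
  Matrix.of fun y z => if Γ.dist y z = i then 1 else 0

/-- The adjacency matrix `A = A_1`. -/
def adjacency (Γ : SimpleGraph X) : Matrix X X ℂ := distMatrix Γ 1

/-- The Bose-Mesner algebra `M`, as the span of the distance matrices `A_0, ..., A_D`. -/
def boseMesner (Γ : SimpleGraph X) : Submodule ℂ (Matrix X X ℂ) :=
  Submodule.span ℂ (Set.range fun i : Fin (Γ.diam + 1) => distMatrix Γ i)

section

variable [DecidableEq X]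

/-- The `i`th dual primitive idempotent `E*_i` with respect to `x`. -/
def dualIdempotent (Γ : SimpleGraph X) (x : X) (i : ℕ) : Matrix X X ℂ :=
  Matrix.diagonal fun y => if Γ.dist x y = i then 1 else 0

/-- The dual Bose-Mesner algebra `M*` with respect to `x`, as the span of `E*_0, ..., E*_D`. -/
def dualBoseMesner (Γ : SimpleGraph X) (x : X) : Submodule ℂ (Matrix X X ℂ) :=
  Submodule.span ℂ (Set.range fun i : Fin (Γ.diam + 1) => dualIdempotent Γ x i)

end

variable [Fintype X]

section

variable [DecidableEq X]

/-- `E_0, ..., E_D` is an ordering of the primitive idempotents of the Bose-Mesner algebra, with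
`E_0 = |X|⁻¹ J`: a basis of `M` of mutually orthogonal idempotents with sum `I`.
The values `E i` with `i > D` play no role. -/
structure IsPrimitiveIdempotents (Γ : SimpleGraph X) (E : ℕ → Matrix X X ℂ) : Prop where
  linearIndependent : LinearIndependent ℂ fun i : Fin (Γ.diam + 1) => E i
  span_eq : Submodule.span ℂ (Set.range fun i : Fin (Γ.diam + 1) => E i) = boseMesner Γ
  zero_eq : E 0 = (Fintype.card X : ℂ)⁻¹ • Matrix.of fun _ _ => 1
  sum_eq : ∑ i ∈ Finset.range (Γ.diam + 1), E i = 1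
  mul_eq : ∀ i ≤ Γ.diam, ∀ j ≤ Γ.diam, E i * E j = if i = j then E i else 0

end

/-- The scalars `q h i j` (`= q^h_{ij}`) are the Krein parameters of `Γ` with respect to the
ordering `E`. -/
def IsKreinParameters (Γ : SimpleGraph X) (E : ℕ → Matrix X X ℂ) (q : ℕ → ℕ → ℕ → ℂ) : Prop :=
  ∀ i ≤ Γ.diam, ∀ j ≤ Γ.diam,
    E i ⊙ E j = (Fintype.card X : ℂ)⁻¹ • ∑ h ∈ Finset.range (Γ.diam + 1), q h i j • E h

/-- The `Q`-polynomial property with respect to the ordering `E` of the primitive idempotents. -/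
def IsQPolynomial (Γ : SimpleGraph X) (E : ℕ → Matrix X X ℂ) : Prop :=
  ∃ q : ℕ → ℕ → ℕ → ℂ, IsKreinParameters Γ E q ∧
    ∀ h ≤ Γ.diam, ∀ i ≤ Γ.diam, ∀ j ≤ Γ.diam,
      ((i + j < h ∨ h + j < i ∨ h + i < j) → q h i j = 0) ∧
      ((h = i + j ∨ i = h + j ∨ j = h + i) → q h i j ≠ 0)

variable [DecidableEq X]

/-- The dual adjacency matrix `A* = A*_1` with respect to `x`. -/
def dualAdjacency (E : ℕ → Matrix X X ℂ) (x : X) : Matrix X X ℂ :=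
  Matrix.diagonal fun y => (Fintype.card X : ℂ) * E 1 x y

/-- The Terwilliger algebra `T(x)`, generated by `M` and `M*`. -/
def terwilligerAlgebra (Γ : SimpleGraph X) (x : X) : Subalgebra ℂ (Matrix X X ℂ) :=
  Algebra.adjoin ℂ ((boseMesner Γ : Set (Matrix X X ℂ)) ∪ (dualBoseMesner Γ x))

/-- `W` is a `T(x)`-module (a `T(x)`-invariant subspace of the standard module). -/
def IsTModule (Γ : SimpleGraph X) (x : X) (W : Submodule ℂ (X → ℂ)) : Prop :=
  ∀ B ∈ terwilligerAlgebra Γ x, ∀ w ∈ W, B *ᵥ w ∈ W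

/-- `W` is an irreducible `T(x)`-module. -/
def IsIrreducibleTModule (Γ : SimpleGraph X) (x : X) (W : Submodule ℂ (X → ℂ)) : Prop :=
  IsTModule Γ x W ∧ W ≠ ⊥ ∧
    ∀ W' : Submodule ℂ (X → ℂ), IsTModule Γ x W' → W' ≤ W → W' = ⊥ ∨ W' = W

/-- The subspace `B W`. -/
def image (B : Matrix X X ℂ) (W : Submodule ℂ (X → ℂ)) : Submodule ℂ (X → ℂ) :=
  W.map (Matrix.mulVecLin B)

/-- `W` is thin: `dim E*_i W ≤ 1` for `0 ≤ i ≤ D`. -/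
def IsThin (Γ : SimpleGraph X) (x : X) (W : Submodule ℂ (X → ℂ)) : Prop :=
  ∀ i ≤ Γ.diam, Module.finrank ℂ (image (dualIdempotent Γ x i) W) ≤ 1

/-- The endpoint of `W`. -/
def endpoint (Γ : SimpleGraph X) (x : X) (W : Submodule ℂ (X → ℂ)) : ℕ :=
  sInf {i : ℕ | i ≤ Γ.diam ∧ image (dualIdempotent Γ x i) W ≠ ⊥}

/-- The dual endpoint of `W`. -/
def dualEndpoint (Γ : SimpleGraph X) (E : ℕ → Matrix X X ℂ) (W : Submodule ℂ (X → ℂ)) : ℕ :=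
  sInf {i : ℕ | i ≤ Γ.diam ∧ image (E i) W ≠ ⊥}

/-- The diameter of `W`. -/
def moduleDiameter (Γ : SimpleGraph X) (x : X) (W : Submodule ℂ (X → ℂ)) : ℕ :=
  {i : ℕ | i ≤ Γ.diam ∧ image (dualIdempotent Γ x i) W ≠ ⊥}.ncard - 1

/-- `w` is a basis of `W`, and `M` represents the action of `B` on `W` with respect to `w`. -/
def IsMatrixRep {n : ℕ} (W : Submodule ℂ (X → ℂ)) (w : Fin n → X → ℂ) (B : Matrix X X ℂ)
    (M : Matrix (Fin n) (Fin n) ℂ) : Prop :=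
  LinearIndependent ℂ w ∧ Submodule.span ℂ (Set.range w) = W ∧
    ∀ j, B *ᵥ w j = ∑ i, M i j • w i

/-- `w` is a standard basis for `W`: `w_i = E*_{r+i} u` with `u` a nonzero vector in `E_t W`,
where `r`, `t`, `d` are the endpoint, dual endpoint and diameter. -/
def IsStandardBasis (Γ : SimpleGraph X) (E : ℕ → Matrix X X ℂ) (x : X)
    (W : Submodule ℂ (X → ℂ)) (w : Fin (moduleDiameter Γ x W + 1) → X → ℂ) : Prop :=
  ∃ u ∈ image (E (dualEndpoint Γ E W)) W, u ≠ 0 ∧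
    ∀ i, w i = dualIdempotent Γ x (endpoint Γ x W + i) *ᵥ u

/-- `w` is a dual standard basis for `W`: `w_i = E_{t+i} v` with `v` a nonzero vector
in `E*_r W`. -/
def IsDualStandardBasis (Γ : SimpleGraph X) (E : ℕ → Matrix X X ℂ) (x : X)
    (W : Submodule ℂ (X → ℂ)) (w : Fin (moduleDiameter Γ x W + 1) → X → ℂ) : Prop :=
  ∃ v ∈ image (dualIdempotent Γ x (endpoint Γ x W)) W, v ≠ 0 ∧
    ∀ i, w i = E (dualEndpoint Γ E W + i) *ᵥ v

/-- The matrix representing `A` with respect to a standard basis for `W` (it does not depend on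
the choice of that basis). -/
def flatMatrix (Γ : SimpleGraph X) (E : ℕ → Matrix X X ℂ) (x : X) (W : Submodule ℂ (X → ℂ)) :
    Matrix (Fin (moduleDiameter Γ x W + 1)) (Fin (moduleDiameter Γ x W + 1)) ℂ :=
  Classical.epsilon fun M => ∃ w, IsStandardBasis Γ E x W w ∧ IsMatrixRep W w (adjacency Γ) M

/-- The matrix representing `A*` with respect to a dual standard basis for `W` (it does not depend
on the choice of that basis). -/
def sharpMatrix (Γ : SimpleGraph X) (E : ℕ → Matrix X X ℂ) (x : X) (W : Submodule ℂ (X → ℂ)) :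
    Matrix (Fin (moduleDiameter Γ x W + 1)) (Fin (moduleDiameter Γ x W + 1)) ℂ :=
  Classical.epsilon fun M =>
    ∃ w, IsDualStandardBasis Γ E x W w ∧ IsMatrixRep W w (dualAdjacency E x) M

/-- The superdiagonal entry `M_{i,i+1}`, and `0` for `i ≥ d`. -/
def superDiag {d : ℕ} (M : Matrix (Fin (d + 1)) (Fin (d + 1)) ℂ) (i : ℕ) : ℂ :=
  if h : i < d then M ⟨i, by omega⟩ ⟨i + 1, by omega⟩ else 0

/-- The subdiagonal entry `M_{i,i-1}`, and `0` for `i = 0` or `i > d`. -/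
def subDiag {d : ℕ} (M : Matrix (Fin (d + 1)) (Fin (d + 1)) ℂ) (i : ℕ) : ℂ :=
  if h : 1 ≤ i ∧ i ≤ d then M ⟨i, by omega⟩ ⟨i - 1, by omega⟩ else 0

/-- The intersection number `b_i(W)`. -/
def bNum (Γ : SimpleGraph X) (E : ℕ → Matrix X X ℂ) (x : X) (W : Submodule ℂ (X → ℂ)) (i : ℕ) :
    ℂ :=
  superDiag (flatMatrix Γ E x W) i

/-- The intersection number `c_i(W)`. -/
def cNum (Γ : SimpleGraph X) (E : ℕ → Matrix X X ℂ) (x : X) (W : Submodule ℂ (X → ℂ)) (i : ℕ) :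
    ℂ :=
  subDiag (flatMatrix Γ E x W) i

/-- The dual intersection number `b*_i(W)`. -/
def bNumDual (Γ : SimpleGraph X) (E : ℕ → Matrix X X ℂ) (x : X) (W : Submodule ℂ (X → ℂ))
    (i : ℕ) : ℂ :=
  superDiag (sharpMatrix Γ E x W) i

/-- The dual intersection number `c*_i(W)`. -/
def cNumDual (Γ : SimpleGraph X) (E : ℕ → Matrix X X ℂ) (x : X) (W : Submodule ℂ (X → ℂ))
    (i : ℕ) : ℂ :=
  subDiag (sharpMatrix Γ E x W) i

/-- The polynomial `τ_i = ∏_{h < i} (λ - θ_{t+h})`. -/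
def tauPoly (θ : ℕ → ℂ) (t i : ℕ) : Polynomial ℂ :=
  ∏ h ∈ Finset.range i, (Polynomial.X - Polynomial.C (θ (t + h)))

/-- The subspace `U_i = τ_i(A) E*_r W`. -/
def splitSpace (Γ : SimpleGraph X) (E : ℕ → Matrix X X ℂ) (θ : ℕ → ℂ) (x : X)
    (W : Submodule ℂ (X → ℂ)) (i : ℕ) : Submodule ℂ (X → ℂ) :=
  image (Polynomial.aeval (adjacency Γ) (tauPoly θ (dualEndpoint Γ E W) i))
    (image (dualIdempotent Γ x (endpoint Γ x W)) W)

/-- The first split sequence: for `1 ≤ i ≤ d`, `φ_i(W)` is the eigenvalue of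
`(A - θ_{t+i-1} I)(A* - θ*_{r+i} I)` on the one-dimensional space `U_i`. -/
def firstSplit (Γ : SimpleGraph X) (E : ℕ → Matrix X X ℂ) (θ θs : ℕ → ℂ) (x : X)
    (W : Submodule ℂ (X → ℂ)) (i : ℕ) : ℂ :=
  Classical.epsilon fun c => ∀ u ∈ splitSpace Γ E θ x W i,
    ((adjacency Γ - θ (dualEndpoint Γ E W + i - 1) • 1) *
      (dualAdjacency E x - θs (endpoint Γ x W + i) • 1)) *ᵥ u = c • u

/-- `f⁺_i` for the sequence `s_0, ..., s_d`. -/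
def fPlus (s : ℕ → ℂ) (d i : ℕ) : ℂ :=
  s 1 - s (i - 1) - (s i - s 0) * (s 1 - s (d - 1)) / (s d - s 0)

/-- `f⁻_i` for the sequence `s_0, ..., s_d`. -/
def fMinus (s : ℕ → ℂ) (d i : ℕ) : ℂ :=
  s 1 - s (i + 1) - (s i - s 0) * (s 1 - s (d - 1)) / (s d - s 0)

/-- `g⁺_i` for the sequences `a_0, ..., a_d` and `s_0, ..., s_d`. -/
def gPlus (a s : ℕ → ℂ) (d i : ℕ) : ℂ :=
  (s i - s 0) * ((a 2 - a 1) * (s i - s d) - (a 1 - a 0) * (s (i - 1) - s (d - 1)))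

/-- `g⁻_i` for the sequences `a_0, ..., a_d` and `s_0, ..., s_d`. -/
def gMinus (a s : ℕ → ℂ) (d i : ℕ) : ℂ :=
  (s i - s 0) * ((a 2 - a 1) * (s i - s d) - (a 1 - a 0) * (s (i + 1) - s (d - 1)))

/-- The sequence `j ↦ a_{m+j}`. -/
def shift (a : ℕ → ℂ) (m : ℕ) : ℕ → ℂ := fun j => a (m + j)

end Terwilliger

end

open Terwilliger

/-! Take `u ≠ 0` in `E_t W`. Thinness and irreducibility make the vectors `E*_{r+i} u` a basis of
`W`, in which `A` is tridiagonal and `u`, `A* u`, `A*² u` have coordinates `1`, `θ*_{r+i}`,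
`(θ*_{r+i})²`. Since `A*` sends each `E_j W` into the sum of itself and its neighbours, `A* u` lies
in the first two eigenspaces of `A` on `W` and `A*² u` in the first three. With `κ u` the
`E_t`-component of `A* u`, this gives `A u = θ_t u`, `A A* u = θ_{t+1} A* u + (θ_t - θ_{t+1}) κ u`,
`A A*² u = θ_{t+2} A*² u + α A* u + β u`. Comparing coordinates yields three linear equations for
the three entries of each row. The unknown `α`, `β` are eliminated by means of rows `0` and `d`,
which have only one off-diagonal entry. The result is the closed form with parameter `φ = (θ_{t+1} -
θ_t)(θ*_r - κ)` (`formulas_of_rows`, `TDSystem.formulas`).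

The dual formulas are the same statement with `A` and `A*` exchanged. Their parameter is `(θ*_{r+1}
- θ*_r)(θ_t - m)`, where `E*_r A` acts as `m` on `E*_r W`, and this is `φ_1` by direct computation
(`TDSystem.split_eigenvalue`). Both parameters agree: row `0` gives `b_0 = θ_t - m`, while the
closed form gives `b_0 = φ / (θ*_{r+1} - θ*_r)`.

It remains to check that `W` fits this setting (`tdSystem`): distinct eigenvalues, the two
tridiagonal relations, and irreducibility under `A` and `A*` alone. Thinness for the `E_i` and
equality of diameter and dual diameter also have to be derived. -/

namespace Terwilliger

/-! ### Tridiagonal systems: invariant flags, supports and cyclic vectors. -/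

section TDSystem

variable {K V : Type*} [Field K] [AddCommGroup V] [Module K V]

/-- Two linear maps `A`, `B` with eigenspace projections `P i`, `Q i` (`i ≤ D`), each acting
tridiagonally on the eigenspaces of the other, and without common invariant subspaces. -/
structure TDSystem (D : ℕ) (A B : Module.End K V) (P Q : ℕ → Module.End K V) (a s : ℕ → K) :
    Prop where
  sum_left : ∀ v, ∑ i ∈ Finset.range (D + 1), P i v = v
  sum_right : ∀ v, ∑ i ∈ Finset.range (D + 1), Q i v = v
  mul_left : ∀ i ≤ D, ∀ j ≤ D, ∀ v, P i (P j v) = if i = j then P i v else 0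
  mul_right : ∀ i ≤ D, ∀ j ≤ D, ∀ v, Q i (Q j v) = if i = j then Q i v else 0
  eig_left : ∀ v, A v = ∑ i ∈ Finset.range (D + 1), a i • P i v
  eig_right : ∀ v, B v = ∑ i ∈ Finset.range (D + 1), s i • Q i v
  tri_left : ∀ i ≤ D, ∀ j ≤ D, (i + 1 < j ∨ j + 1 < i) → ∀ v, P i (B (P j v)) = 0
  tri_right : ∀ i ≤ D, ∀ j ≤ D, (i + 1 < j ∨ j + 1 < i) → ∀ v, Q i (A (Q j v)) = 0
  irred : ∀ S : Submodule K V, (∀ v ∈ S, A v ∈ S) → (∀ v ∈ S, B v ∈ S) → S = ⊥ ∨ S = ⊤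

/-- The maps `Q i` with `i ≤ D` have rank at most one. -/
def RankLeOne (D : ℕ) (Q : ℕ → Module.End K V) : Prop :=
  ∀ i ≤ D, ∀ v w, Q i v ≠ 0 → ∃ c : K, Q i w = c • Q i v

namespace TDSystem

variable {D : ℕ} {A B : Module.End K V} {P Q : ℕ → Module.End K V} {a s : ℕ → K}

theorem swap (h : TDSystem D A B P Q a s) : TDSystem D B A Q P s a where
  sum_left := h.sum_right
  sum_right := h.sum_left
  mul_left := h.mul_right
  mul_right := h.mul_left
  eig_left := h.eig_right
  eig_right := h.eig_left
  tri_left := h.tri_right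
  tri_right := h.tri_left
  irred S h1 h2 := h.irred S h2 h1

theorem right_apply_right (h : TDSystem D A B P Q a s) {i : ℕ} (hi : i ≤ D) (v : V) :
    Q i (B v) = s i • Q i v := by
  rw [h.eig_right, map_sum, Finset.sum_eq_single i]
  · rw [map_smul, h.mul_right i hi i hi, if_pos rfl]
  · intro j hj hji
    rw [map_smul, h.mul_right i hi j (by simpa [Nat.lt_succ_iff] using hj), if_neg (Ne.symm hji),
      smul_zero]
  · intro hn
    exact absurd (Finset.mem_range.2 (by omega)) hn

theorem apply_right (h : TDSystem D A B P Q a s) {i : ℕ} (hi : i ≤ D) (v : V) :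
    B (Q i v) = s i • Q i v := by
  rw [h.eig_right, Finset.sum_eq_single i]
  · rw [h.mul_right i hi i hi, if_pos rfl]
  · intro j hj hji
    rw [h.mul_right j (by simpa [Nat.lt_succ_iff] using hj) i hi, if_neg hji, smul_zero]
  · intro hn
    exact absurd (Finset.mem_range.2 (by omega)) hn

theorem eq_zero_of_right (h : TDSystem D A B P Q a s) {v : V} (hv : ∀ i ≤ D, Q i v = 0) :
    v = 0 := by
  rw [← h.sum_right v]
  exact Finset.sum_eq_zero fun i hi => hv i (by simpa [Nat.lt_succ_iff] using hi)

theorem exists_right_ne_zero (h : TDSystem D A B P Q a s) {v : V} (hv : v ≠ 0) :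
    ∃ i ≤ D, Q i v ≠ 0 := by
  by_contra! hc
  exact hv (h.eq_zero_of_right hc)

theorem right_apply_left_eq_sum (h : TDSystem D A B P Q a s) (i : ℕ) (v : V) :
    Q i (A v) = ∑ j ∈ Finset.range (D + 1), Q i (A (Q j v)) := by
  conv_lhs => rw [← h.sum_right v]
  rw [map_sum, map_sum]

/-- The vectors supported on indices below `k` form a `B`-invariant subspace. By tridiagonality `A`
can leave it only through the component at `k`, which `H` excludes; irreducibility then leaves only
the two extreme cases. -/
theorem flag_lower (h : TDSystem D A B P Q a s) {k : ℕ}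
    (H : ∀ v, (∀ i ≤ D, k ≤ i → Q i v = 0) → k ≤ D → Q k (A v) = 0) :
    (∀ v, (∀ i ≤ D, k ≤ i → Q i v = 0) → v = 0) ∨ ∀ v, ∀ i ≤ D, k ≤ i → Q i v = 0 := by
  let S : Submodule K V :=
    { carrier := {v | ∀ i ≤ D, k ≤ i → Q i v = 0}
      zero_mem' := fun i _ _ => map_zero _
      add_mem' := fun {v w} hv hw i hi hk => by rw [map_add, hv i hi hk, hw i hi hk, add_zero]
      smul_mem' := fun c v hv i hi hk => by rw [map_smul, hv i hi hk, smul_zero] }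
  suffices hS : S = ⊥ ∨ S = ⊤ from hS.imp
    (fun hS v hv => (Submodule.eq_bot_iff S).1 hS v hv) fun hS v => (Submodule.eq_top_iff'.1 hS v : v ∈ S)
  refine h.irred S ?_ ?_
  · intro v hv i hi hki
    rcases hki.eq_or_lt with rfl | hki
    · exact H v hv hi
    · rw [h.right_apply_left_eq_sum]
      refine Finset.sum_eq_zero fun j hj => ?_
      have hj : j ≤ D := by simpa [Nat.lt_succ_iff] using hj
      by_cases hkj : k ≤ j
      · rw [hv j hj hkj, map_zero, map_zero]
      · exact h.tri_right i hi j hj (Or.inr (by omega)) v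
  · intro v hv i hi hki
    rw [h.right_apply_right hi, hv i hi hki, smul_zero]

theorem flag_upper (h : TDSystem D A B P Q a s) {k : ℕ}
    (H : ∀ v, (∀ i ≤ D, i < k → Q i v = 0) → ∀ j ≤ D, j + 1 = k → Q j (A v) = 0) :
    (∀ v, (∀ i ≤ D, i < k → Q i v = 0) → v = 0) ∨ ∀ v, ∀ i ≤ D, i < k → Q i v = 0 := by
  let S : Submodule K V :=
    { carrier := {v | ∀ i ≤ D, i < k → Q i v = 0}
      zero_mem' := fun i _ _ => map_zero _
      add_mem' := fun {v w} hv hw i hi hk => by rw [map_add, hv i hi hk, hw i hi hk, add_zero]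
      smul_mem' := fun c v hv i hi hk => by rw [map_smul, hv i hi hk, smul_zero] }
  suffices hS : S = ⊥ ∨ S = ⊤ from hS.imp
    (fun hS v hv => (Submodule.eq_bot_iff S).1 hS v hv) fun hS v => (Submodule.eq_top_iff'.1 hS v : v ∈ S)
  refine h.irred S ?_ ?_
  · intro v hv i hi hki
    by_cases hik : i + 1 = k
    · exact H v hv i hi hik
    · rw [h.right_apply_left_eq_sum]
      refine Finset.sum_eq_zero fun j hj => ?_
      have hj : j ≤ D := by simpa [Nat.lt_succ_iff] using hj
      by_cases hkj : j < k
      · rw [hv j hj hkj, map_zero, map_zero]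
      · exact h.tri_right i hi j hj (Or.inl (by omega)) v
  · intro v hv i hi hki
    rw [h.right_apply_right hi, hv i hi hki, smul_zero]

/-- The set of indices of the nonzero `Q i` is an interval. -/
theorem right_ne_zero_of_between (h : TDSystem D A B P Q a s) {j k l : ℕ} (hjk : j ≤ k)
    (hkl : k ≤ l) (hl : l ≤ D) (hQj : Q j ≠ 0) (hQl : Q l ≠ 0) : Q k ≠ 0 := by
  intro hk
  have hjk' : j < k := lt_of_le_of_ne hjk fun e => hQj (e ▸ hk)
  -- A gap at `k` makes the lower flag invariant. It contains the image of `Q j`, so it is not zero,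
  -- and it misses the image of `Q l`, so it is not everything.
  rcases h.flag_lower (k := k) fun v _ _ => by rw [hk, LinearMap.zero_apply] with h1 | h1
  · refine hQj (LinearMap.ext fun v => h1 _ fun i hi hki => ?_)
    rw [h.mul_right i hi j (by omega), if_neg (by omega)]
  · exact hQl (LinearMap.ext fun v => h1 v l hl hkl)

/-- An eigenvector of `A` has a nonzero component in the first nonzero eigenspace of `B`. -/
theorem right_first_ne_zero (h : TDSystem D A B P Q a s) (hQ : RankLeOne D Q) {r : ℕ}
    (hrD : r ≤ D) (hr : Q r ≠ 0) (hr' : ∀ i < r, Q i = 0) {c : K} {u : V} (hu : u ≠ 0)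
    (hA : A u = c • u) : Q r u ≠ 0 := by
  intro hru
  have hex := h.exists_right_ne_zero hu
  classical
  obtain ⟨hkD, hk⟩ := Nat.find_spec hex
  have hmin : ∀ i ≤ D, i < Nat.find hex → Q i u = 0 := fun i hi hlt => by
    by_contra hc
    exact Nat.find_min hex hlt ⟨hi, hc⟩
  set k := Nat.find hex
  have hrk : r < k := by
    by_contra hc
    rcases (not_lt.1 hc).eq_or_lt with e | e
    · exact hk (e ▸ hru)
    · exact hk (by rw [hr' k e, LinearMap.zero_apply])
  -- For vectors supported from `k` on, only the component at `k` can contribute to index `k - 1`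
  -- after applying `A`.
  have key : ∀ v, (∀ i ≤ D, i < k → Q i v = 0) → ∀ j ≤ D, j + 1 = k →
      Q j (A v) = Q j (A (Q k v)) := by
    intro v hv j hj hjk
    rw [h.right_apply_left_eq_sum, Finset.sum_eq_single k]
    · intro i hi hik
      have hi : i ≤ D := by simpa [Nat.lt_succ_iff] using hi
      by_cases hlt : i < k
      · rw [hv i hi hlt, map_zero, map_zero]
      · exact h.tri_right j hj i hi (Or.inl (by omega)) v
    · intro hn
      exact absurd (Finset.mem_range.2 (by omega)) hn
  -- By rank one `Q k v` is a multiple of `Q k u`, and `A u = c • u` has no component at `k - 1`.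
  -- Hence the upper flag at `k` is invariant, although it contains `u ≠ 0` and misses the image of
  -- `Q r`.
  rcases h.flag_upper (k := k) fun v hv j hj hjk => by
    obtain ⟨e, he⟩ := hQ k hkD u v hk
    rw [key v hv j hj hjk, he, map_smul, map_smul, ← key u hmin j hj hjk, hA, map_smul,
      hmin j hj (by omega), smul_zero, smul_zero] with h1 | h1
  · exact hu (h1 u hmin)
  · exact hr (LinearMap.ext fun v => h1 v r hrD hrk)

/-- If the eigenspaces of `B` are at most one-dimensional, so are those of `A`. -/
theorem rankLeOne_left (h : TDSystem D A B P Q a s) (hQ : RankLeOne D Q) {r : ℕ}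
    (hrD : r ≤ D) (hr : Q r ≠ 0) (hr' : ∀ i < r, Q i = 0) : RankLeOne D P := by
  intro i hi v w hv
  have hne := h.right_first_ne_zero hQ hrD hr hr' hv (h.swap.apply_right hi v)
  obtain ⟨c, hc⟩ := hQ r hrD (P i v) (P i w) hne
  refine ⟨c, ?_⟩
  by_contra hcon
  -- This vector is an eigenvector of `A` in `P i V` whose `r`-component vanishes by the choice of
  -- `c`, so it cannot be nonzero.
  have hsub : P i (w - c • v) ≠ 0 := by
    rw [map_sub, map_smul]
    exact sub_ne_zero.2 hcon
  refine h.right_first_ne_zero hQ hrD hr hr' hsub (h.swap.apply_right hi _) ?_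
  rw [map_sub, map_sub, map_smul, map_smul, hc, sub_self]

/-- A vector in the first nonzero eigenspace of `A` is cyclic for `B`. -/
theorem eq_top_of_mem (h : TDSystem D A B P Q a s) (hP : RankLeOne D P) {t : ℕ}
    (htD : t ≤ D) (ht' : ∀ i < t, P i = 0) {u : V} (hu : u ≠ 0) (hPu : P t u = u)
    {S : Submodule K V} (huS : u ∈ S) (hBS : ∀ v ∈ S, B v ∈ S) : S = ⊤ := by
  have main : ∀ k ≤ D, ∀ v, P k v ∈ S := by
    intro k
    induction k using Nat.strong_induction_on with
    | _ k ih =>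
    intro hk v
    rcases lt_trichotomy k t with hkt | rfl | hkt
    · rw [ht' k hkt, LinearMap.zero_apply]
      exact S.zero_mem
    · obtain ⟨c, hc⟩ := hP k hk u v (by rwa [hPu])
      rw [hc, hPu]
      exact S.smul_mem c huS
    · obtain ⟨m, rfl⟩ : ∃ m, k = m + 1 := ⟨k - 1, by omega⟩
      -- If `B` reaches the next eigenspace, that image spans it, and subtracting lower components
      -- stays in `S`. If not, the flag up to `m` is invariant and contains `u`, so it is everything
      -- and `P (m + 1) = 0`.
      by_cases hz : ∃ w, P (m + 1) (B (P m w)) ≠ 0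
      · obtain ⟨w, hw⟩ := hz
        obtain ⟨c, hc⟩ := hP (m + 1) hk _ v hw
        rw [hc]
        refine S.smul_mem c ?_
        have hmem := hBS _ (ih m (by omega) (by omega) w)
        have hdec := h.sum_left (B (P m w))
        rw [← Finset.add_sum_erase _ _ (Finset.mem_range.2 (by omega : m + 1 < D + 1)),
          ← eq_sub_iff_add_eq] at hdec
        rw [hdec]
        refine S.sub_mem hmem (S.sum_mem fun j hj => ?_)
        simp only [Finset.mem_erase, Finset.mem_range] at hj
        by_cases hjm : j < m + 1
        · exact ih j hjm (by omega) _
        · rw [h.tri_left j (by omega) m (by omega) (Or.inr (by omega))]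
          exact S.zero_mem
      · push Not at hz
        rcases h.swap.flag_lower (k := m + 1) (fun w hw _ => by
          rw [h.swap.right_apply_left_eq_sum]
          refine Finset.sum_eq_zero fun j hj => ?_
          have hj : j ≤ D := by simpa [Nat.lt_succ_iff] using hj
          rcases lt_trichotomy j m with hjm | rfl | hjm
          · exact h.tri_left _ hk j hj (Or.inr (by omega)) w
          · exact hz w
          · rw [hw j hj (by omega), map_zero, map_zero]) with h1 | h1
        · refine absurd (h1 u fun i hi hmi => ?_) hu
          rw [← hPu, h.mul_left i hi t htD, if_neg (by omega)]
        · rw [h1 v (m + 1) hk le_rfl]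
          exact S.zero_mem
  refine (Submodule.eq_top_iff').2 fun v => ?_
  rw [← h.sum_left v]
  exact S.sum_mem fun j hj => main j (by simpa [Nat.lt_succ_iff] using hj) v

/-- The kernel of `Q k` is `B`-invariant, so it cannot contain the cyclic vector `u` unless `Q k =
0`. -/
theorem right_apply_ne_zero (h : TDSystem D A B P Q a s) (hP : RankLeOne D P) {t : ℕ}
    (htD : t ≤ D) (ht' : ∀ i < t, P i = 0) {u : V} (hu : u ≠ 0) (hPu : P t u = u)
    {k : ℕ} (hk : k ≤ D) (hQk : Q k ≠ 0) : Q k u ≠ 0 := by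
  intro hku
  have := h.eq_top_of_mem hP htD ht' hu hPu (S := LinearMap.ker (Q k)) hku fun v hv => by
    rw [LinearMap.mem_ker] at hv ⊢
    rw [h.right_apply_right hk, hv, smul_zero]
  exact hQk (LinearMap.ker_eq_top.1 this)

end TDSystem

end TDSystem

/-! ### Linear algebra of tridiagonal rows. -/

section Rows

theorem sum_fin_ite_eq {d : ℕ} (k : ℕ) (c : ℂ) :
    (∑ j : Fin (d + 1), if (j : ℕ) = k then c else 0) = if k ≤ d then c else 0 := by
  by_cases hk : k ≤ d
  · rw [if_pos hk, Finset.sum_eq_single (⟨k, by omega⟩ : Fin (d + 1))]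
    · simp
    · intro j _ hj
      rw [if_neg fun e => hj (Fin.ext e)]
    · simp
  · rw [if_neg hk]
    exact Finset.sum_eq_zero fun j _ => if_neg (by omega)

/-- The sum along a row of a tridiagonal matrix. -/
theorem sum_row_of_tridiagonal {d : ℕ} (M : Matrix (Fin (d + 1)) (Fin (d + 1)) ℂ)
    (hM : ∀ i j : Fin (d + 1), ((i : ℕ) + 1 < j ∨ (j : ℕ) + 1 < i) → M i j = 0)
    (g : ℕ → ℂ) (i : Fin (d + 1)) :
    -- The values `g (d + 1)` and, by truncated subtraction, `g (0 - 1) = g 0` occur only with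
    -- coefficient zero.
    ∑ j, M i j * g j = M i i * g i + superDiag M i * g (i + 1) + subDiag M i * g (i - 1) := by
  have hterm : ∀ j : Fin (d + 1), M i j * g j =
      (if (j : ℕ) = i then M i i * g i else 0) +
      (if (j : ℕ) = i + 1 then superDiag M i * g (i + 1) else 0) +
      (if (j : ℕ) = i - 1 then subDiag M i * g (i - 1) else 0) := by
    intro j
    by_cases h1 : (j : ℕ) = i
    · obtain rfl : j = i := Fin.ext h1
      rw [if_pos rfl, if_neg (by omega), add_zero]
      by_cases h0 : (j : ℕ) = j - 1
      · rw [if_pos h0, subDiag, dif_neg (by omega)]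
        ring
      · rw [if_neg h0, add_zero]
    · rw [if_neg h1, zero_add]
      by_cases h2 : (j : ℕ) = i + 1
      · rw [if_pos h2, if_neg (by omega), add_zero, superDiag, dif_pos (by omega), h2]
        congr 2
        exact Fin.ext h2
      · rw [if_neg h2, zero_add]
        by_cases h3 : (j : ℕ) = i - 1
        · rw [if_pos h3, subDiag, dif_pos (by omega), h3]
          congr 2
          exact Fin.ext h3
        · rw [if_neg h3, hM i j (by omega), zero_mul]
  rw [Finset.sum_congr rfl fun j _ => hterm j, Finset.sum_add_distrib, Finset.sum_add_distrib,
    sum_fin_ite_eq, sum_fin_ite_eq, sum_fin_ite_eq, if_pos (by omega : (i : ℕ) ≤ d), if_pos (by omega : (i : ℕ) - 1 ≤ d)]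
  by_cases hi : (i : ℕ) + 1 ≤ d
  · rw [if_pos hi]
  · rw [if_neg hi, superDiag, dif_neg (by omega), zero_mul]

/-- The closed forms for the entries of a tridiagonal matrix with given products with the columns
`(1)`, `(s i)`, `(s i ^ 2)`. -/
theorem formulas_of_rows {d : ℕ} (hd : 1 ≤ d) {a s m b c : ℕ → ℂ} {κ α β φ : ℂ}
    (hs : ∀ i ≤ d, ∀ j ≤ d, i ≠ j → s i ≠ s j) (hc0 : c 0 = 0) (hbd : b d = 0)
    (h0 : ∀ i ≤ d, m i + b i + c i = a 0)
    (h1 : ∀ i ≤ d, m i * s i + b i * s (i + 1) + c i * s (i - 1) = a 1 * s i + (a 0 - a 1) * κ)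
    (h2 : ∀ i ≤ d, m i * s i ^ 2 + b i * s (i + 1) ^ 2 + c i * s (i - 1) ^ 2 =
      a 2 * s i ^ 2 + α * s i + β)
    (hφ : φ = (a 1 - a 0) * (s 0 - κ)) :
    b 0 = φ / (s 1 - s 0) ∧
    (∀ i, 1 ≤ i → i ≤ d - 1 → b i = (φ * fPlus s d i + gPlus a s d i) /
      ((s (i + 1) - s i) * (s (i + 1) - s (i - 1)))) ∧
    (∀ i, 1 ≤ i → i ≤ d - 1 → c i = (φ * fMinus s d i + gMinus a s d i) /
      ((s (i - 1) - s i) * (s (i - 1) - s (i + 1)))) ∧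
    c d = (φ + (a 1 - a 0) * (s d - s 0)) / (s (d - 1) - s d) := by
  -- Subtracting `s i`, respectively `s i ^ 2`, times `h0` removes the diagonal entry.
  have e1 : ∀ i ≤ d, b i * (s (i + 1) - s i) + c i * (s (i - 1) - s i) =
      (a 1 - a 0) * (s i - s 0) + φ := fun i hi => by
    rw [hφ]; linear_combination h1 i hi - s i * h0 i hi
  have e2 : ∀ i ≤ d, b i * (s (i + 1) - s i) * (s (i + 1) + s i) +
      c i * (s (i - 1) - s i) * (s (i - 1) + s i) = (a 2 - a 0) * s i ^ 2 + α * s i + β :=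
    fun i hi => by linear_combination h2 i hi - s i ^ 2 * h0 i hi
  have hne : ∀ i ≤ d, ∀ j ≤ d, i ≠ j → s i - s j ≠ 0 := fun i hi j hj hij =>
    sub_ne_zero.2 (hs i hi j hj hij)
  have e10 := e1 0 (by omega)
  have e20 := e2 0 (by omega)
  have e1d := e1 d le_rfl
  have e2d := e2 d le_rfl
  rw [hc0] at e10 e20
  rw [hbd] at e1d e2d
  simp only [zero_add, zero_mul, add_zero, sub_self, mul_zero] at e10 e20 e1d e2d
  rw [e10] at e20
  rw [e1d] at e2d
  have hd0 := hne d le_rfl 0 (by omega) (by omega)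
  -- Row `d` minus row `0` eliminates `β` and determines `α`; this is the origin of the denominator
  -- `s d - s 0` in `fPlus` and `fMinus`.
  have hα : α * (s d - s 0) = ((a 1 - a 0) * (s d - s 0) + φ) * (s (d - 1) + s d) -
      φ * (s 1 + s 0) - (a 2 - a 0) * (s d ^ 2 - s 0 ^ 2) := by
    linear_combination e20 - e2d
  refine ⟨?_, ?_, ?_, ?_⟩
  · rw [eq_div_iff (hne 1 hd 0 (by omega) (by omega)), e10]
  · intro i hi hid
    have k1 := hne (i + 1) (by omega) i (by omega) (by omega)
    have k2 := hne (i + 1) (by omega) (i - 1) (by omega) (by omega)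
    have q1 := e1 i (by omega)
    have q2 := e2 i (by omega)
    rw [eq_div_iff (mul_ne_zero k1 k2), fPlus, gPlus]
    field_simp
    -- The combination `q2 - (s (i - 1) + s i) * q1` cancels `c i`, `e20` removes `β`, and `hα`
    -- removes `α`.
    linear_combination (s d - s 0) * (q2 - (s (i - 1) + s i) * q1 - e20) + (s i - s 0) * hα
  · intro i hi hid
    have k1 := hne (i - 1) (by omega) i (by omega) (by omega)
    have k2 := hne (i - 1) (by omega) (i + 1) (by omega) (by omega)
    have q1 := e1 i (by omega)
    have q2 := e2 i (by omega)
    rw [eq_div_iff (mul_ne_zero k1 k2), fMinus, gMinus]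
    field_simp
    linear_combination (s d - s 0) * (q2 - (s (i + 1) + s i) * q1 - e20) + (s i - s 0) * hα
  · rw [eq_div_iff (hne (d - 1) (by omega) d le_rfl (by omega)), e1d]
    ring

end Rows

/-! ### The matrix of one map of a tridiagonal system in the eigenbasis of the other. -/

namespace TDSystem

variable {V : Type*} [AddCommGroup V] [Module ℂ V] {D : ℕ} {A B : Module.End ℂ V}
  {P Q : ℕ → Module.End ℂ V} {a s : ℕ → ℂ}

theorem sum_fin_right (h : TDSystem D A B P Q a s) {r d : ℕ} (hrd : r + d ≤ D)
    (hsupp : ∀ i ≤ D, Q i ≠ 0 ↔ r ≤ i ∧ i ≤ r + d) (v : V) :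
    ∑ i : Fin (d + 1), Q (r + i) v = v := by
  rw [Fin.sum_univ_eq_sum_range fun i => Q (r + i) v]
  have := Finset.sum_Ico_eq_sum_range (fun i => Q i v) r (r + d + 1)
  rw [show r + d + 1 - r = d + 1 by omega] at this
  rw [← this]
  conv_rhs => rw [← h.sum_right v]
  refine Finset.sum_subset (fun i hi => ?_) fun i hi hn => ?_
  · rw [Finset.mem_Ico] at hi
    exact Finset.mem_range.2 (by omega)
  · rw [Finset.mem_range] at hi
    rw [Finset.mem_Ico] at hn
    by_contra hc
    have := (hsupp i (by omega)).1 fun e => hc (by rw [e, LinearMap.zero_apply])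
    omega

theorem linearIndependent_right (h : TDSystem D A B P Q a s) {r d : ℕ} (hrd : r + d ≤ D)
    {u : V} (hu : ∀ i ≤ d, Q (r + i) u ≠ 0) :
    LinearIndependent ℂ fun i : Fin (d + 1) => Q (r + i) u := by
  rw [Fintype.linearIndependent_iff]
  intro g hg i
  have := congrArg (Q (r + i)) hg
  rw [map_sum, map_zero, Finset.sum_eq_single i] at this
  · rw [map_smul, h.mul_right _ (by omega) _ (by omega), if_pos rfl] at this
    exact (smul_eq_zero.1 this).resolve_right (hu i (by omega))
  · intro j _ hj
    rw [map_smul, h.mul_right _ (by omega) _ (by omega), if_neg, smul_zero]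
    exact fun e => hj (Fin.ext (by omega))
  · simp

theorem span_right (h : TDSystem D A B P Q a s) (hQ : RankLeOne D Q) {r d : ℕ} (hrd : r + d ≤ D)
    (hsupp : ∀ i ≤ D, Q i ≠ 0 ↔ r ≤ i ∧ i ≤ r + d) {u : V} (hu : ∀ i ≤ d, Q (r + i) u ≠ 0) :
    Submodule.span ℂ (Set.range fun i : Fin (d + 1) => Q (r + i) u) = ⊤ := by
  refine Submodule.eq_top_iff'.2 fun v => ?_
  rw [← h.sum_fin_right hrd hsupp v]
  refine Submodule.sum_mem _ fun i _ => ?_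
  obtain ⟨c, hc⟩ := hQ (r + i) (by omega) u v (hu i (by omega))
  rw [hc]
  exact Submodule.smul_mem _ _ (Submodule.subset_span ⟨i, rfl⟩)

theorem finrank_eq (h : TDSystem D A B P Q a s) (hQ : RankLeOne D Q) {r d : ℕ} (hrd : r + d ≤ D)
    (hsupp : ∀ i ≤ D, Q i ≠ 0 ↔ r ≤ i ∧ i ≤ r + d) {u : V} (hu : ∀ i ≤ d, Q (r + i) u ≠ 0) :
    Module.finrank ℂ V = d + 1 := by
  have hb := Module.finrank_eq_card_basis (Module.Basis.mk (h.linearIndependent_right hrd hu)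
    (h.span_right hQ hrd hsupp hu).ge)
  rwa [Fintype.card_fin] at hb

/-- The entries of the matrix of `A` with respect to the basis `Q (r + i) u`. -/
theorem right_apply_left_right (h : TDSystem D A B P Q a s) {r d : ℕ} (hrd : r + d ≤ D)
    {u : V} {M : Matrix (Fin (d + 1)) (Fin (d + 1)) ℂ}
    (hM : ∀ j : Fin (d + 1), A (Q (r + j) u) = ∑ i, M i j • Q (r + i) u) (i j : Fin (d + 1)) :
    Q (r + i) (A (Q (r + j) u)) = M i j • Q (r + i) u := by
  rw [hM, map_sum, Finset.sum_eq_single i]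
  · rw [map_smul, h.mul_right _ (by omega) _ (by omega), if_pos rfl]
  · intro k _ hk
    rw [map_smul, h.mul_right _ (by omega) _ (by omega), if_neg, smul_zero]
    exact fun e => hk (Fin.ext (by omega))
  · simp

/-- This turns an identity for `A x` into an equation for each row of `M`; it is applied to `x = u`,
`B u` and `B (B u)`. -/
theorem row_eq (h : TDSystem D A B P Q a s) {r d : ℕ} (hrd : r + d ≤ D)
    (hsupp : ∀ i ≤ D, Q i ≠ 0 ↔ r ≤ i ∧ i ≤ r + d) {u : V} (hu : ∀ i ≤ d, Q (r + i) u ≠ 0)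
    {M : Matrix (Fin (d + 1)) (Fin (d + 1)) ℂ}
    (hM : ∀ j : Fin (d + 1), A (Q (r + j) u) = ∑ i, M i j • Q (r + i) u) {p p' : ℕ → ℂ} {x : V}
    (hx : ∀ i ≤ d, Q (r + i) x = p i • Q (r + i) u)
    (hAx : ∀ i ≤ d, Q (r + i) (A x) = p' i • Q (r + i) u) (i : Fin (d + 1)) :
    M i i * p i + superDiag M i * p (i + 1) + subDiag M i * p (i - 1) = p' i := by
  rw [← sum_row_of_tridiagonal M]
  · have e := hAx i (by omega)
    have hxs := h.sum_fin_right hrd hsupp x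
    rw [← hxs, map_sum, map_sum, Finset.sum_congr rfl fun j _ => by
      rw [hx j (by omega), map_smul, map_smul, h.right_apply_left_right hrd hM, smul_smul],
      ← Finset.sum_smul] at e
    rw [← smul_left_injective ℂ (hu i (by omega)) e]
    exact Finset.sum_congr rfl fun j _ => mul_comm _ _
  · intro j k hjk
    have e := h.right_apply_left_right hrd hM j k
    rw [h.tri_right _ (by omega) _ (by omega) (by omega)] at e
    exact (smul_eq_zero.1 e.symm).resolve_right (hu j (by omega))

/-- The action of `A` on vectors supported on the first two eigenspaces. -/
theorem left_apply_of_two (h : TDSystem D A B P Q a s) {t : ℕ} (ht : t ≤ D) {y : V}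
    (hy : ∀ j ≤ D, j ≠ t → j ≠ t + 1 → P j y = 0) :
    A y = a (t + 1) • y + (a t - a (t + 1)) • P t y := by
  rw [← sub_eq_zero]
  refine h.swap.eq_zero_of_right fun j hj => ?_
  rw [map_sub, map_add, map_smul, map_smul, h.swap.right_apply_right hj, h.mul_left j hj t ht]
  by_cases h1 : j = t
  · subst h1
    rw [if_pos rfl]
    module
  · rw [if_neg h1]
    by_cases h2 : j = t + 1
    · subst h2
      module
    · rw [hy j hj h1 h2]
      simp

/-- The case `t + 2 > D` is allowed: then `y = P t y + P (t + 1) y`, and the terms with `a (t + 2)`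
cancel whatever its value. -/
theorem left_apply_of_three (h : TDSystem D A B P Q a s) {t : ℕ} (ht : t + 1 ≤ D) {y : V}
    (hy : ∀ j ≤ D, j ≠ t → j ≠ t + 1 → j ≠ t + 2 → P j y = 0) :
    A y = a (t + 2) • y + (a t - a (t + 2)) • P t y +
      (a (t + 1) - a (t + 2)) • P (t + 1) y := by
  rw [← sub_eq_zero]
  refine h.swap.eq_zero_of_right fun j hj => ?_
  rw [map_sub, map_add, map_add, map_smul, map_smul, map_smul, h.swap.right_apply_right hj,
    h.mul_left j hj t (by omega), h.mul_left j hj (t + 1) ht]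
  by_cases h1 : j = t
  · subst h1
    rw [if_pos rfl, if_neg (by omega)]
    module
  · rw [if_neg h1]
    by_cases h2 : j = t + 1
    · subst h2
      rw [if_pos rfl]
      module
    · rw [if_neg h2]
      by_cases h3 : j = t + 2
      · subst h3
        module
      · rw [hy j hj h1 h2 h3]
        simp

theorem left_apply_right_eq_zero (h : TDSystem D A B P Q a s) {t : ℕ} (ht : t ≤ D)
    (ht' : ∀ i < t, P i = 0) {u : V} (hPu : P t u = u) {j : ℕ} (hj : j ≤ D) (h1 : j ≠ t)
    (h2 : j ≠ t + 1) : P j (B u) = 0 := by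
  rcases lt_or_gt_of_ne h1 with hlt | hlt
  · rw [ht' j hlt, LinearMap.zero_apply]
  · rw [← hPu]
    exact h.tri_left j hj t ht (Or.inr (by omega)) u

theorem left_apply_right_right_eq_zero (h : TDSystem D A B P Q a s) {t : ℕ} (ht : t ≤ D)
    (ht' : ∀ i < t, P i = 0) {u : V} (hPu : P t u = u) {j : ℕ} (hj : j ≤ D) (h1 : j ≠ t)
    (h2 : j ≠ t + 1) (h3 : j ≠ t + 2) : P j (B (B u)) = 0 := by
  rcases lt_or_gt_of_ne h1 with hlt | hlt
  · rw [ht' j hlt, LinearMap.zero_apply]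
  · rw [h.swap.right_apply_left_eq_sum]
    refine Finset.sum_eq_zero fun k hk => ?_
    have hk : k ≤ D := by simpa [Nat.lt_succ_iff] using hk
    by_cases hkt : k ≤ t + 1
    · exact h.tri_left j hj k hk (Or.inr (by omega)) _
    · rw [h.left_apply_right_eq_zero ht ht' hPu hk (by omega) (by omega), map_zero, map_zero]

theorem right_apply_eq_of_left (h : TDSystem D A B P Q a s) {t : ℕ} (ht : t + 1 ≤ D)
    (ht' : ∀ i < t, P i = 0) {u : V} (hPu : P t u = u) :
    B u = P t (B u) + P (t + 1) (B u) := by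
  conv_lhs => rw [← h.sum_left (B u)]
  refine Finset.sum_eq_add_of_mem t (t + 1) (Finset.mem_range.2 (by omega))
    (Finset.mem_range.2 (by omega)) (by omega) fun j hj hne => ?_
  exact h.left_apply_right_eq_zero (by omega) ht' hPu (by simpa [Nat.lt_succ_iff] using hj)
    hne.1 hne.2

/-- By rank one, the components of `B (B u)` at `t` and `t + 1` are multiples of `u` and of `B u - κ
• u`. The values of `α` and `β` do not matter, since `formulas_of_rows` eliminates them. -/
theorem exists_left_apply_right_right (h : TDSystem D A B P Q a s) (hP : RankLeOne D P) {t : ℕ}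
    (ht : t + 1 ≤ D) (ht' : ∀ i < t, P i = 0) {u : V} (hu : u ≠ 0) (hPu : P t u = u) :
    ∃ α β : ℂ, A (B (B u)) = a (t + 2) • B (B u) + α • B u + β • u := by
  have hPu' : P t u ≠ 0 := by rwa [hPu]
  obtain ⟨κ, hκ⟩ := hP t (by omega) u (B u) hPu'
  obtain ⟨ν, hν⟩ := hP t (by omega) u (B (B u)) hPu'
  rw [hPu] at hκ hν
  obtain ⟨μ, hμ⟩ : ∃ μ : ℂ, P (t + 1) (B (P (t + 1) (B u))) = μ • P (t + 1) (B u) := by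
    by_cases hz : P (t + 1) (B u) = 0
    · exact ⟨0, by rw [hz, map_zero, map_zero, zero_smul]⟩
    · exact hP (t + 1) ht _ _ hz
  have hB := h.right_apply_eq_of_left ht ht' hPu
  have hPB : P (t + 1) (B u) = B u - κ • u := by
    rw [hκ] at hB
    exact eq_sub_of_add_eq' hB.symm
  have hPBB : P (t + 1) (B (B u)) = (κ + μ) • (B u - κ • u) := by
    conv_lhs => rw [hB]
    rw [hκ, map_add, map_add, hμ, map_smul, map_smul, hPB, add_smul]
  refine ⟨(a (t + 1) - a (t + 2)) * (κ + μ),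
    (a t - a (t + 2)) * ν - (a (t + 1) - a (t + 2)) * (κ + μ) * κ, ?_⟩
  rw [h.left_apply_of_three ht fun j hj h1 h2 h3 =>
    h.left_apply_right_right_eq_zero (by omega) ht' hPu hj h1 h2 h3, hν, hPBB]
  module

/-- The closed forms for the entries of the matrix of `A` with respect to the basis
`Q (r + i) u`. -/
theorem formulas (h : TDSystem D A B P Q a s) (hP : RankLeOne D P) {r t d : ℕ} (hd : 1 ≤ d)
    (hrd : r + d ≤ D) (hsupp : ∀ i ≤ D, Q i ≠ 0 ↔ r ≤ i ∧ i ≤ r + d)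
    (ht : t + 1 ≤ D) (ht' : ∀ i < t, P i = 0)
    (hs : ∀ i ≤ D, ∀ j ≤ D, i ≠ j → s i ≠ s j)
    {u : V} (hu : u ≠ 0) (hPu : P t u = u)
    {M : Matrix (Fin (d + 1)) (Fin (d + 1)) ℂ}
    (hM : ∀ j : Fin (d + 1), A (Q (r + j) u) = ∑ i, M i j • Q (r + i) u)
    {κ φ : ℂ} (hκ : P t (B u) = κ • u) (hφ : φ = (a (t + 1) - a t) * (s r - κ)) :
    (superDiag M 0 = φ / (s (r + 1) - s r) ∧
      (∀ i : ℕ, 1 ≤ i → i ≤ d - 1 → superDiag M i =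
          (φ * fPlus (shift s r) d i + gPlus (shift a t) (shift s r) d i) /
            ((s (r + i + 1) - s (r + i)) * (s (r + i + 1) - s (r + i - 1)))) ∧
      (∀ i : ℕ, 1 ≤ i → i ≤ d - 1 → subDiag M i =
          (φ * fMinus (shift s r) d i + gMinus (shift a t) (shift s r) d i) /
            ((s (r + i - 1) - s (r + i)) * (s (r + i - 1) - s (r + i + 1)))) ∧
      subDiag M d = (φ + (a (t + 1) - a t) * (s (r + d) - s r)) / (s (r + d - 1) - s (r + d))) ∧
    superDiag M 0 = a t - M 0 0 := by
  have htD : t ≤ D := by omega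
  have hne : ∀ i ≤ d, Q (r + i) u ≠ 0 := fun i hi =>
    h.right_apply_ne_zero hP htD ht' hu hPu (by omega)
      ((hsupp (r + i) (by omega)).2 ⟨by omega, by omega⟩)
  have hAu : A u = a t • u := by
    conv_lhs => rw [← hPu]
    rw [h.swap.apply_right htD, hPu]
  have hBu : ∀ i ≤ d, Q (r + i) (B u) = shift s r i • Q (r + i) u := fun i hi =>
    h.right_apply_right (by omega) u
  have hBBu : ∀ i ≤ d, Q (r + i) (B (B u)) = shift s r i ^ 2 • Q (r + i) u := fun i hi => by
    rw [h.right_apply_right (by omega), h.right_apply_right (by omega), smul_smul, sq]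
    rfl
  obtain ⟨α, β, hαβ⟩ := h.exists_left_apply_right_right hP ht ht' hu hPu
  have r0 := h.row_eq hrd hsupp hne hM (p := fun _ => 1) (p' := fun _ => a t) (x := u)
    (fun i _ => (one_smul _ _).symm) fun i _ => by rw [hAu, map_smul]
  have r1 := h.row_eq hrd hsupp hne hM (p := shift s r)
    (p' := fun i => a (t + 1) * shift s r i + (a t - a (t + 1)) * κ) (x := B u)
    hBu fun i hi => by
      rw [h.left_apply_of_two htD fun j hj h1 h2 =>
        h.left_apply_right_eq_zero htD ht' hPu hj h1 h2, hκ, map_add, map_smul, map_smul,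
        map_smul, hBu i hi]
      module
  have r2 := h.row_eq hrd hsupp hne hM (p := fun i => shift s r i ^ 2)
    (p' := fun i => a (t + 2) * shift s r i ^ 2 + α * shift s r i + β) (x := B (B u))
    hBBu fun i hi => by
      rw [hαβ, map_add, map_add, map_smul, map_smul, map_smul, hBu i hi, hBBu i hi]
      module
  have hsub0 : subDiag M 0 = 0 := dif_neg (by omega)
  constructor
  · have key := formulas_of_rows hd (a := shift a t) (s := shift s r)
      (m := fun i => if hi : i < d + 1 then M ⟨i, hi⟩ ⟨i, hi⟩ else 0)
      (b := superDiag M) (c := subDiag M) (κ := κ) (α := α) (β := β) (φ := φ)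
      (fun i hi j hj hij => hs _ (by omega) _ (by omega) (by omega)) hsub0
      (dif_neg (by omega))
      (fun i hi => by
        simp only [dif_pos (show i < d + 1 by omega)]
        have := r0 ⟨i, by omega⟩
        simp only [mul_one] at this
        exact this)
      (fun i hi => by
        simp only [dif_pos (show i < d + 1 by omega)]
        exact r1 ⟨i, by omega⟩)
      (fun i hi => by
        simp only [dif_pos (show i < d + 1 by omega)]
        exact r2 ⟨i, by omega⟩) hφ
    obtain ⟨k0, k1, k2, k3⟩ := key
    refine ⟨k0, fun i hi hid => ?_, fun i hi hid => ?_, ?_⟩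
    · rw [Nat.add_sub_assoc hi]
      exact k1 i hi hid
    · rw [Nat.add_sub_assoc hi]
      exact k2 i hi hid
    · rw [Nat.add_sub_assoc hd]
      exact k3
  · have := r0 0
    simp only [Fin.val_zero, hsub0, mul_one, add_zero] at this
    exact eq_sub_of_add_eq' this

/-- The eigenvalue that defines the first entry of the first split sequence. -/
theorem split_eigenvalue (h : TDSystem D A B P Q a s) {r : ℕ} (hr : r ≤ D)
    (hr' : ∀ i < r, Q i = 0) {v : V} (hQv : Q r v = v) {m e : ℂ} (hm : Q r (A v) = m • v)
    {z : V} (hz : z = A v - e • v) :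
    A (B z - s (r + 1) • z) - e • (B z - s (r + 1) • z) = ((e - m) * (s (r + 1) - s r)) • z := by
  have hB : B z = s (r + 1) • z + (s r - s (r + 1)) • Q r z :=
    -- The vector `z` lives at indices `r` and `r + 1`, so `B - s (r + 1)` maps it to a multiple of
    -- `v`, and `A - e` maps `v` back to `z`.
    h.swap.left_apply_of_two hr fun j hj h1 h2 => by
      rw [hz, map_sub, map_smul, h.swap.left_apply_right_eq_zero hr hr' hQv hj h1 h2, ← hQv,
        h.mul_right j hj r hr, if_neg h1, smul_zero, sub_zero]
  have hQz : Q r z = (m - e) • v := by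
    rw [hz, map_sub, map_smul, hm, hQv, sub_smul]
  rw [hB, add_sub_cancel_left, hQz, map_smul, map_smul, hz]
  module

end TDSystem

/-! ### Distance-regular graphs: generators, distinct eigenvalues, and the two tridiagonal
relations. -/

section Graph

/-- If `θ i = θ j`, every polynomial in `a` acts by the same scalar on `P i` and on `P j`; but `P i`
is such a polynomial and acts as `1` on one and `0` on the other. -/
theorem ne_of_mem_adjoin {R : Type*} [Ring R] [Algebra ℂ R] {D : ℕ} {a : R} {P : ℕ → R}
    {θ : ℕ → ℂ} (hmul : ∀ i ≤ D, ∀ j ≤ D, P i * P j = if i = j then P i else 0)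
    (hne : ∀ i ≤ D, P i ≠ 0) (ha : a = ∑ i ∈ Finset.range (D + 1), θ i • P i)
    (hmem : ∀ i ≤ D, P i ∈ Algebra.adjoin ℂ {a}) :
    ∀ i ≤ D, ∀ j ≤ D, i ≠ j → θ i ≠ θ j := by
  intro i hi j hj hij hθ
  have haP : ∀ k ≤ D, a * P k = θ k • P k := fun k hk => by
    rw [ha, Finset.sum_mul, Finset.sum_eq_single k]
    · rw [smul_mul_assoc, hmul k hk k hk, if_pos rfl]
    · intro l hl hlk
      rw [smul_mul_assoc, hmul l (by simpa [Nat.lt_succ_iff] using hl) k hk, if_neg hlk, smul_zero]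
    · intro hn
      exact absurd (Finset.mem_range.2 (by omega)) hn
  have key : ∀ b ∈ Algebra.adjoin ℂ {a}, ∃ c : ℂ, b * P i = c • P i ∧ b * P j = c • P j := by
    intro b hb
    induction hb using Algebra.adjoin_induction with
    | mem b hb =>
      rw [Set.mem_singleton_iff.1 hb]
      exact ⟨θ i, haP i hi, hθ ▸ haP j hj⟩
    | algebraMap c => exact ⟨c, by rw [Algebra.smul_def], by rw [Algebra.smul_def]⟩
    | add b b' _ _ h h' =>
      obtain ⟨c, h1, h2⟩ := h
      obtain ⟨c', h1', h2'⟩ := h'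
      exact ⟨c + c', by rw [add_mul, h1, h1', add_smul], by rw [add_mul, h2, h2', add_smul]⟩
    | mul b b' _ _ h h' =>
      obtain ⟨c, h1, h2⟩ := h
      obtain ⟨c', h1', h2'⟩ := h'
      exact ⟨c' * c, by rw [mul_assoc, h1', mul_smul_comm, h1, smul_smul],
        by rw [mul_assoc, h2', mul_smul_comm, h2, smul_smul]⟩
  obtain ⟨c, h1, h2⟩ := key _ (hmem i hi)
  rw [hmul i hi i hi, if_pos rfl] at h1
  rw [hmul i hi j hj, if_neg hij] at h2
  rcases smul_eq_zero.1 h2.symm with rfl | h0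
  · exact hne i hi (by rw [h1, zero_smul])
  · exact hne j hj h0

variable {X : Type*} {Γ : SimpleGraph X}

theorem exists_adj_dist_eq (hc : Γ.Connected) {y z : X} {n : ℕ} (h : Γ.dist y z = n + 1) :
    ∃ w, Γ.dist y w = 1 ∧ Γ.dist w z = n := by
  obtain ⟨p, hp⟩ := hc.exists_walk_length_eq_dist y z
  cases p with
  | nil => rw [SimpleGraph.dist_self] at h; omega
  | @cons _ w _ hadj q =>
    rw [SimpleGraph.Walk.length_cons, h] at hp
    have h1 := SimpleGraph.dist_eq_one_iff_adj.2 hadj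
    refine ⟨w, h1, ?_⟩
    have h2 := SimpleGraph.dist_le q
    have h3 := hc.dist_triangle (u := y) (v := w) (w := z)
    omega

theorem exists_dist_eq_of_le (hc : Γ.Connected) {y z : X} {i : ℕ} (hi : i ≤ Γ.dist y z) :
    ∃ w, Γ.dist w z = i := by
  obtain ⟨n, hn⟩ : ∃ n, Γ.dist y z = i + n := ⟨_, (Nat.add_sub_cancel' hi).symm⟩
  induction n generalizing y with
  | zero => exact ⟨y, hn⟩
  | succ n ih =>
    obtain ⟨w, -, hw⟩ := exists_adj_dist_eq hc (n := i + n) (by omega)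
    exact ih (y := w) (by omega) hw

theorem distMatrix_transpose (Γ : SimpleGraph X) (i : ℕ) : (distMatrix Γ i)ᵀ = distMatrix Γ i := by
  ext y z
  simp only [Matrix.transpose_apply, distMatrix, Matrix.of_apply]
  rw [SimpleGraph.dist_comm]

theorem distMatrix_conjTranspose (Γ : SimpleGraph X) (i : ℕ) :
    (distMatrix Γ i)ᴴ = distMatrix Γ i := by
  ext y z
  simp only [Matrix.conjTranspose_apply, distMatrix, Matrix.of_apply]
  rw [SimpleGraph.dist_comm]
  split_ifs <;> simp

theorem transpose_eq_of_mem_boseMesner {B : Matrix X X ℂ} (hB : B ∈ boseMesner Γ) : Bᵀ = B := by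
  induction hB using Submodule.span_induction with
  | mem B hB =>
    obtain ⟨i, rfl⟩ := hB
    exact distMatrix_transpose Γ i
  | zero => exact Matrix.transpose_zero
  | add B C _ _ hB hC => rw [Matrix.transpose_add, hB, hC]
  | smul c B _ hB => rw [Matrix.transpose_smul, hB]

theorem conjTranspose_mem_boseMesner {B : Matrix X X ℂ} (hB : B ∈ boseMesner Γ) :
    Bᴴ ∈ boseMesner Γ := by
  induction hB using Submodule.span_induction with
  | mem B hB =>
    obtain ⟨i, rfl⟩ := hB
    simp only [distMatrix_conjTranspose]
    exact Submodule.subset_span ⟨i, rfl⟩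
  | zero => rw [Matrix.conjTranspose_zero]; exact Submodule.zero_mem _
  | add B C _ _ hB hC => rw [Matrix.conjTranspose_add]; exact Submodule.add_mem _ hB hC
  | smul c B _ hB => rw [Matrix.conjTranspose_smul]; exact Submodule.smul_mem _ _ hB

variable [Fintype X]

theorem IsDistanceRegular.dist_le_diam (hΓ : IsDistanceRegular Γ) (y z : X) :
    Γ.dist y z ≤ Γ.diam :=
  have := hΓ.1.nonempty
  SimpleGraph.dist_le_diam (SimpleGraph.connected_iff_ediam_ne_top.1 hΓ.1)

theorem IsDistanceRegular.exists_dist_eq (hΓ : IsDistanceRegular Γ) (x : X) {i : ℕ}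
    (hi : i ≤ Γ.diam) : ∃ y, Γ.dist x y = i := by
  have := hΓ.1.nonempty
  obtain ⟨y, z, hyz⟩ := Γ.exists_dist_eq_diam
  obtain ⟨w, hw⟩ := exists_dist_eq_of_le hΓ.1 (hyz ▸ hi : i ≤ Γ.dist y z)
  rw [SimpleGraph.dist_comm] at hw
  -- Some vertex `z` has a vertex at distance `i`; the number `p 0 i i` of such vertices is the same
  -- for `z` and `x`.
  obtain ⟨p, hp⟩ := hΓ.2
  have h1 := hp z z i i
  have h2 := hp x x i i
  rw [SimpleGraph.dist_self] at h1 h2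
  rw [← h1] at h2
  have h3 : {w | Γ.dist z w = i ∧ Γ.dist z w = i}.ncard ≠ 0 :=
    Set.ncard_ne_zero_of_mem (a := w) ⟨hw, hw⟩
  rw [← h2] at h3
  obtain ⟨y, hy⟩ := Set.nonempty_of_ncard_ne_zero h3
  exact ⟨y, hy.1⟩

theorem adjacency_mul_distMatrix {p : ℕ → ℕ → ℕ → ℕ}
    (hp : ∀ (y z : X) (i j : ℕ),
      {w : X | Γ.dist y w = i ∧ Γ.dist z w = j}.ncard = p (Γ.dist y z) i j) (i : ℕ) (y z : X) :
    (adjacency Γ * distMatrix Γ i) y z = p (Γ.dist y z) 1 i := by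
  classical
  rw [← hp, Matrix.mul_apply, Set.ncard_eq_toFinset_card', Set.toFinset_ofPred,
    Finset.natCast_card_filter]
  refine Finset.sum_congr rfl fun w _ => ?_
  simp only [adjacency, distMatrix, Matrix.of_apply]
  rw [Γ.dist_comm (u := w)]
  by_cases h1 : Γ.dist y w = 1 <;> by_cases h2 : Γ.dist z w = i <;> simp [h1, h2]

variable [DecidableEq X]

theorem distMatrix_mem_adjoin (hΓ : IsDistanceRegular Γ) (i : ℕ) :
    distMatrix Γ i ∈ Algebra.adjoin ℂ {adjacency Γ} := by
  obtain ⟨hc, p, hp⟩ := hΓ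
  induction i using Nat.strong_induction_on with
  | _ i ih =>
  rcases i with _ | i
  · have : distMatrix Γ 0 = 1 := by
      ext y z
      simp only [distMatrix, Matrix.of_apply, Matrix.one_apply, hc.dist_eq_zero_iff]
    rw [this]
    exact Subalgebra.one_mem _
  -- Three-term recurrence: by the triangle inequality `A A_i` involves no `A_h` with `h > i + 1`,
  -- so it can be solved for `A_{i+1}`.
  · have hrec : (p (i + 1) 1 i : ℂ) • distMatrix Γ (i + 1) = adjacency Γ * distMatrix Γ i -
        ∑ h ∈ Finset.range (i + 1), (p h 1 i : ℂ) • distMatrix Γ h := by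
      ext y z
      rw [Matrix.sub_apply, adjacency_mul_distMatrix hp, Matrix.sum_apply]
      simp only [Matrix.smul_apply, distMatrix, Matrix.of_apply, smul_eq_mul, mul_ite, mul_one,
        mul_zero, Finset.sum_ite_eq, Finset.mem_range]
      rcases lt_trichotomy (Γ.dist y z) (i + 1) with h | h | h
      · rw [if_neg h.ne, if_pos h, sub_self]
      · rw [if_pos h, if_neg h.not_lt, sub_zero, h]
      · rw [if_neg h.ne', if_neg h.not_gt, sub_zero, ← hp]
        symm
        rw [Nat.cast_eq_zero, Set.ncard_eq_zero (Set.toFinite _), Set.eq_empty_iff_forall_notMem]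
        rintro w ⟨h1, h2⟩
        have := hc.dist_triangle (u := y) (v := w) (w := z)
        rw [Γ.dist_comm (u := w)] at this
        omega
    have hmem : (p (i + 1) 1 i : ℂ) • distMatrix Γ (i + 1) ∈ Algebra.adjoin ℂ {adjacency Γ} := by
      rw [hrec]
      refine Subalgebra.sub_mem _ (Subalgebra.mul_mem _ (Algebra.self_mem_adjoin_singleton _ _)
        (ih i (by omega))) (Subalgebra.sum_mem _ fun h hh => Subalgebra.smul_mem _ (ih h ?_) _)
      exact Finset.mem_range.1 hh
    by_cases hex : ∃ y z, Γ.dist y z = i + 1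
    · obtain ⟨y, z, hyz⟩ := hex
      obtain ⟨w, hw1, hw2⟩ := exists_adj_dist_eq hc hyz
      have hne : p (i + 1) 1 i ≠ 0 := by
        rw [← hyz, ← hp]
        refine Set.ncard_ne_zero_of_mem (a := w) ⟨hw1, ?_⟩
        rw [SimpleGraph.dist_comm, hw2]
      have := Subalgebra.smul_mem _ hmem (p (i + 1) 1 i : ℂ)⁻¹
      rwa [smul_smul, inv_mul_cancel₀ (Nat.cast_ne_zero.2 hne), one_smul] at this
    · push Not at hex
      have : distMatrix Γ (i + 1) = 0 := by
        ext y z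
        simp [distMatrix, hex y z]
      rw [this]
      exact Subalgebra.zero_mem _

theorem boseMesner_le_adjoin (hΓ : IsDistanceRegular Γ) {B : Matrix X X ℂ}
    (hB : B ∈ boseMesner Γ) : B ∈ Algebra.adjoin ℂ {adjacency Γ} := by
  suffices h : boseMesner Γ ≤ Subalgebra.toSubmodule (Algebra.adjoin ℂ {adjacency Γ}) from h hB
  rw [boseMesner, Submodule.span_le]
  rintro _ ⟨i, rfl⟩
  exact distMatrix_mem_adjoin hΓ i

variable {E : ℕ → Matrix X X ℂ}

theorem IsPrimitiveIdempotents.mem_boseMesner (hE : IsPrimitiveIdempotents Γ E) {i : ℕ}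
    (hi : i ≤ Γ.diam) : E i ∈ boseMesner Γ := by
  rw [← hE.span_eq]
  exact Submodule.subset_span ⟨⟨i, by omega⟩, rfl⟩

theorem IsPrimitiveIdempotents.ne_zero (hE : IsPrimitiveIdempotents Γ E) {i : ℕ}
    (hi : i ≤ Γ.diam) : E i ≠ 0 :=
  hE.linearIndependent.ne_zero (⟨i, by omega⟩ : Fin (Γ.diam + 1))

theorem IsPrimitiveIdempotents.exists_mul_eq_smul (hE : IsPrimitiveIdempotents Γ E)
    {B : Matrix X X ℂ} (hB : B ∈ boseMesner Γ) {i : ℕ} (hi : i ≤ Γ.diam) :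
    ∃ c : ℂ, E i * B = c • E i := by
  rw [← hE.span_eq, Submodule.mem_span_range_iff_exists_fun] at hB
  obtain ⟨c, rfl⟩ := hB
  refine ⟨c ⟨i, by omega⟩, ?_⟩
  rw [Finset.mul_sum, Finset.sum_eq_single (⟨i, by omega⟩ : Fin (Γ.diam + 1))]
  · rw [mul_smul_comm, hE.mul_eq i hi i hi, if_pos rfl]
  · intro j _ hj
    rw [mul_smul_comm, hE.mul_eq i hi j (by omega), if_neg, smul_zero]
    exact fun e => hj (Fin.ext e.symm)
  · simp

theorem IsPrimitiveIdempotents.transpose_eq (hE : IsPrimitiveIdempotents Γ E) {i : ℕ}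
    (hi : i ≤ Γ.diam) : (E i)ᵀ = E i :=
  transpose_eq_of_mem_boseMesner (hE.mem_boseMesner hi)

open scoped ComplexOrder in
-- `E_i E_iᴴ = c E_i` because `M` is closed under conjugate transpose. Taking adjoints and
-- multiplying by `E_i` gives `c̄ c = c`, and `c ≠ 0` since `E_i ≠ 0`; hence `c = 1`.
theorem IsPrimitiveIdempotents.conjTranspose_eq (hE : IsPrimitiveIdempotents Γ E) {i : ℕ}
    (hi : i ≤ Γ.diam) : (E i)ᴴ = E i := by
  obtain ⟨c, hc⟩ := hE.exists_mul_eq_smul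
    (conjTranspose_mem_boseMesner (hE.mem_boseMesner hi)) hi
  have hEE : E i * E i = E i := by rw [hE.mul_eq i hi i hi, if_pos rfl]
  have hc0 : c ≠ 0 := by
    rintro rfl
    rw [zero_smul, Matrix.self_mul_conjTranspose_eq_zero] at hc
    exact hE.ne_zero hi hc
  have h1 : star c • (E i)ᴴ = c • E i := by
    rw [← hc, ← Matrix.conjTranspose_smul, ← hc, Matrix.conjTranspose_mul,
      Matrix.conjTranspose_conjTranspose]
  have h2 : (star c * c) • E i = c • E i := by
    rw [← smul_smul, ← hc, ← mul_smul_comm, h1, mul_smul_comm, hEE, hc]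
  have h3 : star c * c = c := smul_left_injective ℂ (hE.ne_zero hi) h2
  have h4 : star c = 1 := by
    rwa [mul_eq_right₀ hc0] at h3
  have h5 : c = 1 := by rw [← star_star c, h4, star_one]
  rwa [h5, star_one, one_smul, one_smul] at h1

theorem IsPrimitiveIdempotents.ne_of_adjacency_eq (hE : IsPrimitiveIdempotents Γ E)
    (hΓ : IsDistanceRegular Γ) {θ : ℕ → ℂ}
    (hθ : adjacency Γ = ∑ i ∈ Finset.range (Γ.diam + 1), θ i • E i) :
    ∀ i ≤ Γ.diam, ∀ j ≤ Γ.diam, i ≠ j → θ i ≠ θ j :=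
  ne_of_mem_adjoin hE.mul_eq (fun _ hi => hE.ne_zero hi) hθ fun _ hi =>
    boseMesner_le_adjoin hΓ (hE.mem_boseMesner hi)

/-- The diagonal matrix formed from the row `x` of `|X| B`. -/
noncomputable def rowDiagonal (x : X) : Matrix X X ℂ →ₗ[ℂ] Matrix X X ℂ where
  toFun B := Matrix.diagonal fun y => (Fintype.card X : ℂ) * B x y
  map_add' B C := by
    rw [Matrix.diagonal_add]
    congr 1
    ext y
    rw [Matrix.add_apply, mul_add]
  map_smul' c B := by
    rw [RingHom.id_apply, ← Matrix.diagonal_smul]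
    congr 1
    ext y
    simp only [Matrix.smul_apply, Pi.smul_apply, smul_eq_mul]
    ring

theorem rowDiagonal_apply (x : X) (B : Matrix X X ℂ) :
    rowDiagonal x B = Matrix.diagonal fun y => (Fintype.card X : ℂ) * B x y := rfl

/-- Entrywise products become ordinary products of diagonal matrices; this carries the Krein
relations over to the dual algebra. -/
theorem rowDiagonal_hadamard (x : X) (B C : Matrix X X ℂ) :
    rowDiagonal x B * rowDiagonal x C = (Fintype.card X : ℂ) • rowDiagonal x (B ⊙ C) := by
  rw [rowDiagonal_apply, rowDiagonal_apply, rowDiagonal_apply, Matrix.diagonal_mul_diagonal,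
    ← Matrix.diagonal_smul]
  congr 1
  ext y
  simp only [Pi.smul_apply, Matrix.hadamard_apply, smul_eq_mul]
  ring

theorem rowDiagonal_distMatrix (Γ : SimpleGraph X) (x : X) (i : ℕ) :
    rowDiagonal x (distMatrix Γ i) = (Fintype.card X : ℂ) • dualIdempotent Γ x i := by
  rw [rowDiagonal_apply, dualIdempotent, ← Matrix.diagonal_smul]
  rfl

/-- Dual three-term recurrence: `A* A*_i` involves no `A*_h` with `h > i + 1`, and the coefficient
`q^{i+1}_{1i}` of `A*_{i+1}` is nonzero. -/
theorem rowDiagonal_mem_adjoin (hE : IsPrimitiveIdempotents Γ E) (hQ : IsQPolynomial Γ E)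
    (hD : 1 ≤ Γ.diam) (x : X) {i : ℕ} (hi : i ≤ Γ.diam) :
    rowDiagonal x (E i) ∈ Algebra.adjoin ℂ {dualAdjacency E x} := by
  have : Nonempty X := ⟨x⟩
  have hn : (Fintype.card X : ℂ) ≠ 0 := Nat.cast_ne_zero.2 Fintype.card_ne_zero
  obtain ⟨q, hq, hq'⟩ := hQ
  induction i using Nat.strong_induction_on with
  | _ i ih =>
  rcases i with _ | i
  · have : rowDiagonal x (E 0) = 1 := by
      rw [hE.zero_eq, rowDiagonal_apply, ← Matrix.diagonal_one]
      congr 1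
      ext y
      simp [hn]
    rw [this]
    exact Subalgebra.one_mem _
  · have hmul : dualAdjacency E x * rowDiagonal x (E i) =
        ∑ h ∈ Finset.range (Γ.diam + 1), q h 1 i • rowDiagonal x (E h) := by
      have : dualAdjacency E x = rowDiagonal x (E 1) := rfl
      rw [this, rowDiagonal_hadamard, hq 1 hD i (by omega), map_smul, smul_smul,
        mul_inv_cancel₀ hn, one_smul, map_sum]
      exact Finset.sum_congr rfl fun h _ => map_smul _ _ _
    rw [← Finset.add_sum_erase _ _ (Finset.mem_range.2 (by omega : i + 1 < Γ.diam + 1)),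
      ← sub_eq_iff_eq_add] at hmul
    have hmem : q (i + 1) 1 i • rowDiagonal x (E (i + 1)) ∈
        Algebra.adjoin ℂ {dualAdjacency E x} := by
      rw [← hmul]
      refine Subalgebra.sub_mem _ (Subalgebra.mul_mem _ (Algebra.self_mem_adjoin_singleton _ _)
        (ih i (by omega) (by omega))) (Subalgebra.sum_mem _ fun h hh => ?_)
      simp only [Finset.mem_erase, Finset.mem_range] at hh
      by_cases hhi : h < i + 1
      · exact Subalgebra.smul_mem _ (ih h hhi (by omega)) _
      · rw [(hq' h (by omega) 1 hD i (by omega)).1 (Or.inl (by omega)), zero_smul]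
        exact Subalgebra.zero_mem _
    have hne := (hq' (i + 1) hi 1 hD i (by omega)).2 (Or.inl (by omega))
    have := Subalgebra.smul_mem _ hmem (q (i + 1) 1 i)⁻¹
    rwa [smul_smul, inv_mul_cancel₀ hne, one_smul] at this

theorem dualIdempotent_mem_adjoin (hE : IsPrimitiveIdempotents Γ E) (hQ : IsQPolynomial Γ E)
    (hD : 1 ≤ Γ.diam) (x : X) {i : ℕ} (hi : i ≤ Γ.diam) :
    dualIdempotent Γ x i ∈ Algebra.adjoin ℂ {dualAdjacency E x} := by
  have : Nonempty X := ⟨x⟩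
  have hn : (Fintype.card X : ℂ) ≠ 0 := Nat.cast_ne_zero.2 Fintype.card_ne_zero
  have h1 : distMatrix Γ i ∈ boseMesner Γ := Submodule.subset_span ⟨⟨i, by omega⟩, rfl⟩
  rw [← hE.span_eq, Submodule.mem_span_range_iff_exists_fun] at h1
  obtain ⟨c, hc⟩ := h1
  have h2 : rowDiagonal x (distMatrix Γ i) ∈ Algebra.adjoin ℂ {dualAdjacency E x} := by
    rw [← hc, map_sum]
    refine Subalgebra.sum_mem _ fun j _ => ?_
    rw [map_smul]
    exact Subalgebra.smul_mem _ (rowDiagonal_mem_adjoin hE hQ hD x (by omega)) _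
  rw [rowDiagonal_distMatrix] at h2
  have := Subalgebra.smul_mem _ h2 (Fintype.card X : ℂ)⁻¹
  rwa [smul_smul, inv_mul_cancel₀ hn, one_smul] at this

theorem dualIdempotent_mul (Γ : SimpleGraph X) (x : X) (i j : ℕ) :
    dualIdempotent Γ x i * dualIdempotent Γ x j = if i = j then dualIdempotent Γ x i else 0 := by
  rw [dualIdempotent, dualIdempotent, Matrix.diagonal_mul_diagonal]
  split_ifs with hij
  · subst hij
    congr 1
    ext y
    split_ifs <;> simp
  · rw [← Matrix.diagonal_zero]
    congr 1
    ext y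
    by_cases h1 : Γ.dist x y = i
    · rw [if_neg (fun h2 => hij (h1.symm.trans h2)), mul_zero]
    · rw [if_neg h1, zero_mul]

theorem sum_dualIdempotent (hΓ : IsDistanceRegular Γ) (x : X) :
    ∑ i ∈ Finset.range (Γ.diam + 1), dualIdempotent Γ x i = 1 := by
  ext y z
  rw [Matrix.sum_apply, Matrix.one_apply]
  simp only [dualIdempotent, Matrix.diagonal_apply]
  split_ifs with h
  · rw [Finset.sum_ite_eq, if_pos (Finset.mem_range.2 (Nat.lt_succ_of_le (hΓ.dist_le_diam x y)))]
  · simp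

theorem dualIdempotent_ne_zero (hΓ : IsDistanceRegular Γ) (x : X) {i : ℕ} (hi : i ≤ Γ.diam) :
    dualIdempotent Γ x i ≠ 0 := by
  obtain ⟨y, hy⟩ := hΓ.exists_dist_eq x hi
  intro h
  have := congrFun (congrFun h y) y
  simp [dualIdempotent, hy] at this

theorem ne_of_dualAdjacency_eq (hΓ : IsDistanceRegular Γ) (hE : IsPrimitiveIdempotents Γ E)
    (hQ : IsQPolynomial Γ E) (hD : 1 ≤ Γ.diam) {x : X} {θs : ℕ → ℂ}
    (hθs : dualAdjacency E x = ∑ i ∈ Finset.range (Γ.diam + 1), θs i • dualIdempotent Γ x i) :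
    ∀ i ≤ Γ.diam, ∀ j ≤ Γ.diam, i ≠ j → θs i ≠ θs j :=
  ne_of_mem_adjoin (fun i _ j _ => dualIdempotent_mul Γ x i j)
    (fun _ hi => dualIdempotent_ne_zero hΓ x hi) hθs fun _ hi =>
    dualIdempotent_mem_adjoin hE hQ hD x hi

theorem dualIdempotent_mul_adjacency_mul (hΓ : IsDistanceRegular Γ) (x : X) {i j : ℕ}
    (hij : i + 1 < j ∨ j + 1 < i) :
    dualIdempotent Γ x i * adjacency Γ * dualIdempotent Γ x j = 0 := by
  ext y z
  rw [dualIdempotent, dualIdempotent, Matrix.mul_diagonal, Matrix.diagonal_mul, adjacency,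
    distMatrix, Matrix.of_apply, Matrix.zero_apply]
  by_cases h1 : Γ.dist x y = i
  · by_cases h2 : Γ.dist x z = j
    · rw [if_neg (c := Γ.dist y z = 1), mul_zero, zero_mul]
      intro h3
      have k1 := hΓ.1.dist_triangle (u := x) (v := y) (w := z)
      have k2 := hΓ.1.dist_triangle (u := x) (v := z) (w := y)
      rw [Γ.dist_comm (u := z)] at k2
      omega
    · rw [if_neg h2, mul_zero]
  · rw [if_neg h1, zero_mul, zero_mul]

open scoped ComplexOrder in
theorem mul_dualAdjacency_mul (hE : IsPrimitiveIdempotents Γ E) (hQ : IsQPolynomial Γ E)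
    (hD : 1 ≤ Γ.diam) (x : X) {i j : ℕ} (hi : i ≤ Γ.diam) (hj : j ≤ Γ.diam)
    (hij : i + 1 < j ∨ j + 1 < i) : E i * dualAdjacency E x * E j = 0 := by
  obtain ⟨q, hq, hq'⟩ := hQ
  have hsymm : ∀ k ≤ Γ.diam, ∀ y z, E k y z = E k z y := fun k hk y z =>
    congrFun (congrFun (hE.transpose_eq hk) z) y
  have hA : (dualAdjacency E x)ᴴ = dualAdjacency E x := by
    rw [dualAdjacency, Matrix.diagonal_conjTranspose]
    congr 1
    ext y
    have := congrFun (congrFun (hE.conjTranspose_eq hD) y) x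
    rw [Matrix.conjTranspose_apply] at this
    rw [Pi.star_apply, star_mul', this, hsymm 1 hD y x, star_natCast]
  have hidem : ∀ k ≤ Γ.diam, E k * E k = E k := fun k hk => by
    rw [hE.mul_eq k hk k hk, if_pos rfl]
  -- Only the coefficient `q^1_{ij}` survives between the two factors `E 1`, and it vanishes for `|i
  -- - j| > 1`.
  have hprod : E 1 * (E i ⊙ E j) * E 1 = 0 := by
    rw [hq i hi j hj, mul_smul_comm, Finset.mul_sum, smul_mul_assoc, Finset.sum_mul,
      Finset.sum_eq_zero, smul_zero]
    intro h hh
    have hh : h ≤ Γ.diam := by simpa [Nat.lt_succ_iff] using hh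
    rw [mul_smul_comm, smul_mul_assoc, hE.mul_eq 1 hD h hh]
    split_ifs with h1
    · subst h1
      rw [(hq' 1 hD i hi j hj).1 (by omega), zero_smul]
    · rw [zero_mul, smul_zero]
  -- The squared Frobenius norm of `E_i A* E_j` equals `|X|²` times the `(x, x)`-entry of the
  -- product in `hprod`.
  rw [← Matrix.trace_mul_conjTranspose_self_eq_zero_iff, Matrix.conjTranspose_mul,
    Matrix.conjTranspose_mul, hA, hE.conjTranspose_eq hi, hE.conjTranspose_eq hj]
  have hcyc : (E i * dualAdjacency E x * E j * (E j * (dualAdjacency E x * E i))).trace =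
      (E i * dualAdjacency E x * (E j * dualAdjacency E x)).trace := by
    rw [Matrix.trace_mul_comm]
    rw [show E j * (dualAdjacency E x * E i) * (E i * dualAdjacency E x * E j) =
      E j * (dualAdjacency E x * (E i * E i) * dualAdjacency E x * E j) by noncomm_ring,
      hidem i hi, Matrix.trace_mul_comm,
      show dualAdjacency E x * E i * dualAdjacency E x * E j * E j =
        dualAdjacency E x * (E i * dualAdjacency E x * (E j * E j)) by noncomm_ring,
      hidem j hj, Matrix.trace_mul_comm]
    congr 1
    noncomm_ring
  rw [hcyc]
  have hentry : (E i * dualAdjacency E x * (E j * dualAdjacency E x)).trace =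
      (Fintype.card X : ℂ) ^ 2 * (E 1 * (E i ⊙ E j) * E 1) x x := by
    rw [Matrix.trace, Matrix.mul_apply, Finset.mul_sum]
    refine Finset.sum_congr rfl fun y _ => ?_
    rw [Matrix.diag_apply, Matrix.mul_apply, Matrix.mul_apply, Finset.sum_mul, Finset.mul_sum]
    refine Finset.sum_congr rfl fun z _ => ?_
    rw [dualAdjacency, Matrix.mul_diagonal, Matrix.mul_diagonal, Matrix.hadamard_apply,
      hsymm i hi z y, hsymm 1 hD y x]
    ring
  rw [hentry, hprod, Matrix.zero_apply, mul_zero]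

end Graph

theorem mem_iff_of_interval {S : Set ℕ} (hfin : S.Finite) (hne : S.Nonempty)
    (hS : ∀ j ∈ S, ∀ l ∈ S, ∀ k, j ≤ k → k ≤ l → k ∈ S) (i : ℕ) :
    i ∈ S ↔ sInf S ≤ i ∧ i ≤ sInf S + (S.ncard - 1) := by
  have hinf := Nat.sInf_mem hne
  obtain ⟨m, hm, hmax⟩ := hfin.exists_maximalFor id S hne
  have hle : ∀ i ∈ S, i ≤ m := fun i hi => by
    by_contra hc
    exact hc (hmax hi (le_of_lt (not_le.1 hc)))
  have hIcc : S = Set.Icc (sInf S) m := Set.ext fun i =>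
    ⟨fun hi => ⟨Nat.sInf_le hi, hle i hi⟩, fun hi => hS _ hinf _ hm _ hi.1 hi.2⟩
  have hcard : S.ncard = m + 1 - sInf S := by
    conv_lhs => rw [hIcc]
    rw [Set.ncard_eq_toFinset_card', Set.toFinset_Icc, Nat.card_Icc]
  have := hle _ hinf
  rw [hcard]
  constructor
  · intro hi
    have := hle i hi
    have := Nat.sInf_le hi
    omega
  · intro hi
    exact hS _ hinf _ hm _ hi.1 (by omega)

/-! ### Restriction of matrices to an invariant subspace, and the chosen matrix representations. -/

section Action

variable {X : Type*} [Fintype X]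

open Classical in
/-- The action of `B` on `W`, and `0` if `W` is not invariant under `B`. -/
noncomputable def act (W : Submodule ℂ (X → ℂ)) (B : Matrix X X ℂ) : Module.End ℂ W :=
  if h : ∀ w ∈ W, B *ᵥ w ∈ W then (Matrix.mulVecLin B).restrict h else 0

variable {W : Submodule ℂ (X → ℂ)} {B C : Matrix X X ℂ}

theorem coe_act (hB : ∀ w ∈ W, B *ᵥ w ∈ W) (v : W) : (act W B v : X → ℂ) = B *ᵥ (v : X → ℂ) := by
  rw [act, dif_pos hB]
  rfl

theorem act_ne_zero_iff (hB : ∀ w ∈ W, B *ᵥ w ∈ W) : act W B ≠ 0 ↔ image B W ≠ ⊥ := by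
  rw [not_iff_not, image, Submodule.eq_bot_iff]
  constructor
  · rintro h _ ⟨w, hw, rfl⟩
    have := congrArg Subtype.val (LinearMap.congr_fun h ⟨w, hw⟩)
    rwa [coe_act hB] at this
  · intro h
    refine LinearMap.ext fun v => Subtype.ext ?_
    rw [coe_act hB]
    exact h _ ⟨v, v.2, rfl⟩

theorem exists_act_eq_smul (hB : ∀ w ∈ W, B *ᵥ w ∈ W)
    (h : Module.finrank ℂ (image B W) ≤ 1) (v w : W) (hv : act W B v ≠ 0) :
    ∃ c : ℂ, act W B w = c • act W B v := by
  obtain ⟨z, hz⟩ := finrank_le_one_iff.1 h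
  obtain ⟨c, hc⟩ := hz ⟨B *ᵥ v, v, v.2, rfl⟩
  obtain ⟨e, he⟩ := hz ⟨B *ᵥ w, w, w.2, rfl⟩
  have hc' : c • (z : X → ℂ) = act W B v := by rw [coe_act hB]; exact congrArg Subtype.val hc
  have he' : e • (z : X → ℂ) = act W B w := by rw [coe_act hB]; exact congrArg Subtype.val he
  have hc0 : c ≠ 0 := by
    rintro rfl
    rw [zero_smul] at hc'
    exact hv (Subtype.ext hc'.symm)
  refine ⟨e * c⁻¹, Subtype.ext ?_⟩
  rw [Submodule.coe_smul, ← he', ← hc', smul_smul, mul_assoc, inv_mul_cancel₀ hc0, mul_one]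

theorem isMatrixRep_iff {n : ℕ} (hB : ∀ w ∈ W, B *ᵥ w ∈ W) {w : Fin n → W}
    {M : Matrix (Fin n) (Fin n) ℂ} (hli : LinearIndependent ℂ w)
    (hspan : Submodule.span ℂ (Set.range w) = ⊤) :
    IsMatrixRep W (fun i => (w i : X → ℂ)) B M ↔ ∀ j, act W B (w j) = ∑ i, M i j • w i := by
  have h1 : LinearIndependent ℂ fun i => (w i : X → ℂ) :=
    hli.map' W.subtype W.ker_subtype
  have h2 : Submodule.span ℂ (Set.range fun i => (w i : X → ℂ)) = W := by
    have := congrArg (Submodule.map W.subtype) hspan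
    rw [Submodule.map_span, ← Set.range_comp, Submodule.map_subtype_top] at this
    exact this
  have h3 : ∀ j, (B *ᵥ (w j : X → ℂ) = ∑ i, M i j • (w i : X → ℂ)) ↔
      act W B (w j) = ∑ i, M i j • w i := fun j => by
    rw [← coe_act hB, Subtype.ext_iff, AddSubmonoidClass.coe_finsetSum]
    rfl
  exact ⟨fun h j => (h3 j).1 (h.2.2 j), fun h => ⟨h1, h2, fun j => (h3 j).2 (h j)⟩⟩

variable {D : ℕ} {P Q : ℕ → Matrix X X ℂ} {a s : ℕ → ℂ}

/-- The set of indices `i` with `Q i W ≠ 0` is an interval. -/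
theorem act_ne_zero_iff_mem_interval
    (h : TDSystem D (act W B) (act W C) (fun i => act W (P i)) (fun i => act W (Q i)) a s)
    (hQ : ∀ i ≤ D, ∀ w ∈ W, Q i *ᵥ w ∈ W) (hW : W ≠ ⊥) (i : ℕ) :
    (i ≤ D ∧ act W (Q i) ≠ 0) ↔ sInf {i : ℕ | i ≤ D ∧ image (Q i) W ≠ ⊥} ≤ i ∧
      i ≤ sInf {i : ℕ | i ≤ D ∧ image (Q i) W ≠ ⊥} +
        ({i : ℕ | i ≤ D ∧ image (Q i) W ≠ ⊥}.ncard - 1) := by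
  have hset : {i : ℕ | i ≤ D ∧ image (Q i) W ≠ ⊥} = {i : ℕ | i ≤ D ∧ act W (Q i) ≠ 0} :=
    Set.ext fun i => and_congr_right fun hi => (act_ne_zero_iff (hQ i hi)).symm
  rw [hset, ← mem_iff_of_interval, Set.mem_ofPred_eq]
  · exact (Set.finite_Iic D).subset fun i hi => hi.1
  · obtain ⟨w, hw, hw0⟩ := (Submodule.ne_bot_iff W).1 hW
    obtain ⟨i, hi, hne⟩ := h.exists_right_ne_zero (v := ⟨w, hw⟩)
      fun e => hw0 (congrArg Subtype.val e)
    exact ⟨i, hi, fun e => hne (by simp only [e, LinearMap.zero_apply])⟩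
  · rintro j ⟨_, hj⟩ l ⟨hl, hl'⟩ k hjk hkl
    exact ⟨by omega, h.right_ne_zero_of_between hjk hkl hl hj hl'⟩

/-- The matrix chosen by `Classical.epsilon` represents `B` with respect to a basis
`Q (r + i) u` with `u` in the image of `P t`. -/
theorem exists_epsilon_spec
    (h : TDSystem D (act W B) (act W C) (fun i => act W (P i)) (fun i => act W (Q i)) a s)
    (hQr : RankLeOne D fun i => act W (Q i)) (hPr : RankLeOne D fun i => act W (P i))
    (hB : ∀ w ∈ W, B *ᵥ w ∈ W) (hP : ∀ i ≤ D, ∀ w ∈ W, P i *ᵥ w ∈ W)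
    (hQ : ∀ i ≤ D, ∀ w ∈ W, Q i *ᵥ w ∈ W) {r t d : ℕ} (hrd : r + d ≤ D)
    (hsupp : ∀ i ≤ D, act W (Q i) ≠ 0 ↔ r ≤ i ∧ i ≤ r + d) (htD : t ≤ D)
    (ht : act W (P t) ≠ 0) (ht' : ∀ i < t, act W (P i) = 0) :
    ∃ u : W, u ≠ 0 ∧ act W (P t) u = u ∧ ∀ j : Fin (d + 1), act W B (act W (Q (r + j)) u) =
      ∑ i : Fin (d + 1), (Classical.epsilon fun M : Matrix (Fin (d + 1)) (Fin (d + 1)) ℂ =>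
        ∃ w, (∃ u ∈ image (P t) W, u ≠ 0 ∧ ∀ i : Fin (d + 1), w i = Q (r + i) *ᵥ u) ∧
          IsMatrixRep W w B M) i j • act W (Q (r + i)) u := by
  have hidem : ∀ v, act W (P t) (act W (P t) v) = act W (P t) v := fun v => by
    rw [h.mul_left t htD t htD, if_pos rfl]
  have hne : ∀ u : W, u ≠ 0 → act W (P t) u = u → ∀ i ≤ d, act W (Q (r + i)) u ≠ 0 :=
    fun u hu hPu i hi => h.right_apply_ne_zero hPr htD ht' hu hPu (by omega)
      ((hsupp (r + i) (by omega)).2 ⟨by omega, by omega⟩)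
  have hcoe : ∀ u : W, (fun i : Fin (d + 1) => Q (r + i) *ᵥ (u : X → ℂ)) =
      fun i : Fin (d + 1) => ((act W (Q (r + i)) u : W) : X → ℂ) := fun u =>
    funext fun i => (coe_act (hQ _ (by omega)) u).symm
  -- Existence of one representing matrix suffices: the closed forms hold for any admissible `u`, so
  -- independence of the choice is never required.
  obtain ⟨w, ⟨u, hu, hu0, hw⟩, hrep⟩ := Classical.epsilon_spec
    (p := fun M : Matrix (Fin (d + 1)) (Fin (d + 1)) ℂ =>
      ∃ w, (∃ u ∈ image (P t) W, u ≠ 0 ∧ ∀ i : Fin (d + 1), w i = Q (r + i) *ᵥ u) ∧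
        IsMatrixRep W w B M) <| by
    obtain ⟨v, hv⟩ : ∃ v, act W (P t) v ≠ 0 := by
      by_contra! hc
      exact ht (LinearMap.ext hc)
    have hn := hne _ hv (hidem v)
    have hli := h.linearIndependent_right hrd hn
    have hspan := h.span_right hQr hrd hsupp hn
    have hex : ∀ j : Fin (d + 1), ∃ c : Fin (d + 1) → ℂ,
        ∑ i : Fin (d + 1), c i • act W (Q (r + i)) (act W (P t) v) =
          act W B (act W (Q (r + j)) (act W (P t) v)) := fun j =>
      (Submodule.mem_span_range_iff_exists_fun ℂ).1 (by rw [hspan]; exact Submodule.mem_top)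
    choose c hc using hex
    refine ⟨Matrix.of fun i j => c j i, _, ⟨act W (P t) v, ?_, fun e => hv (Subtype.ext e), fun i => rfl⟩, ?_⟩
    · rw [coe_act (hP t htD)]
      exact ⟨v, v.2, rfl⟩
    · rw [hcoe, isMatrixRep_iff hB hli hspan]
      exact fun j => (hc j).symm
  obtain ⟨v, hv, rfl⟩ := hu
  have huv : (Matrix.mulVecLin (P t)) v = ((act W (P t) ⟨v, hv⟩ : W) : X → ℂ) :=
    (coe_act (hP t htD) ⟨v, hv⟩).symm
  rw [huv] at hu0 hw
  have hu0' : act W (P t) ⟨v, hv⟩ ≠ 0 := fun e => hu0 (by rw [e]; rfl)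
  refine ⟨act W (P t) ⟨v, hv⟩, hu0', hidem _, ?_⟩
  have hn := hne _ hu0' (hidem _)
  obtain rfl := funext hw
  rw [hcoe, isMatrixRep_iff hB (h.linearIndependent_right hrd hn)
    (h.span_right hQr hrd hsupp hn)] at hrep
  exact hrep

end Action

/-! ### The tridiagonal system on an irreducible module, and the first split eigenvalue. -/

section Module

variable {X : Type*} [Fintype X] [DecidableEq X] {Γ : SimpleGraph X} {E : ℕ → Matrix X X ℂ} {x : X}

theorem mem_terwilligerAlgebra_of_mem_boseMesner {B : Matrix X X ℂ} (hB : B ∈ boseMesner Γ) :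
    B ∈ terwilligerAlgebra Γ x :=
  Algebra.subset_adjoin (Or.inl hB)

theorem dualIdempotent_mem_terwilligerAlgebra {i : ℕ} (hi : i ≤ Γ.diam) :
    dualIdempotent Γ x i ∈ terwilligerAlgebra Γ x :=
  Algebra.subset_adjoin (Or.inr (Submodule.subset_span ⟨⟨i, by omega⟩, rfl⟩))

/-- A subspace that is invariant under `A` and `A*` is a `T`-module. -/
theorem isTModule_of_invariant (hΓ : IsDistanceRegular Γ) (hE : IsPrimitiveIdempotents Γ E)
    (hQ : IsQPolynomial Γ E) (hD : 1 ≤ Γ.diam) {S : Submodule ℂ (X → ℂ)}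
    (hA : ∀ v ∈ S, adjacency Γ *ᵥ v ∈ S) (hAs : ∀ v ∈ S, dualAdjacency E x *ᵥ v ∈ S) :
    IsTModule Γ x S := by
  let T : Subalgebra ℂ (Matrix X X ℂ) :=
    { carrier := {B | ∀ v ∈ S, B *ᵥ v ∈ S}
      mul_mem' := fun {B C} hB hC v hv => by
        rw [← Matrix.mulVec_mulVec]
        exact hB _ (hC v hv)
      add_mem' := fun {B C} hB hC v hv => by
        rw [Matrix.add_mulVec]
        exact S.add_mem (hB v hv) (hC v hv)
      algebraMap_mem' := fun c v hv => by
        rw [Algebra.algebraMap_eq_smul_one, Matrix.smul_mulVec, Matrix.one_mulVec]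
        exact S.smul_mem c hv }
  have h1 : Algebra.adjoin ℂ {adjacency Γ} ≤ T :=
    Algebra.adjoin_le (Set.singleton_subset_iff.2 hA)
  have h2 : Algebra.adjoin ℂ {dualAdjacency E x} ≤ T :=
    Algebra.adjoin_le (Set.singleton_subset_iff.2 hAs)
  have h3 : dualBoseMesner Γ x ≤ Subalgebra.toSubmodule T := by
    rw [dualBoseMesner, Submodule.span_le]
    rintro _ ⟨i, rfl⟩
    exact h2 (dualIdempotent_mem_adjoin hE hQ hD x (by omega))
  have h4 : terwilligerAlgebra Γ x ≤ T := Algebra.adjoin_le (Set.union_subset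
    (fun B hB => h1 (boseMesner_le_adjoin hΓ hB)) fun B hB => h3 hB)
  exact fun B hB => h4 hB

theorem tdSystem (hΓ : IsDistanceRegular Γ) (hD : 1 ≤ Γ.diam) (hE : IsPrimitiveIdempotents Γ E)
    (hQ : IsQPolynomial Γ E) {θ θs : ℕ → ℂ}
    (hθ : adjacency Γ = ∑ i ∈ Finset.range (Γ.diam + 1), θ i • E i)
    (hθs : dualAdjacency E x = ∑ i ∈ Finset.range (Γ.diam + 1), θs i • dualIdempotent Γ x i)
    {W : Submodule ℂ (X → ℂ)} (hW : IsIrreducibleTModule Γ x W)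
    (hA : ∀ w ∈ W, adjacency Γ *ᵥ w ∈ W) (hAs : ∀ w ∈ W, dualAdjacency E x *ᵥ w ∈ W)
    (hEW : ∀ i ≤ Γ.diam, ∀ w ∈ W, E i *ᵥ w ∈ W)
    (hEsW : ∀ i ≤ Γ.diam, ∀ w ∈ W, dualIdempotent Γ x i *ᵥ w ∈ W) :
    TDSystem Γ.diam (act W (adjacency Γ)) (act W (dualAdjacency E x)) (fun i => act W (E i))
      (fun i => act W (dualIdempotent Γ x i)) θ θs := by
  have hsum : ∀ (F : ℕ → Matrix X X ℂ) (_ : ∀ i ≤ Γ.diam, ∀ w ∈ W, F i *ᵥ w ∈ W) (c : ℕ → ℂ)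
      (v : W), ((∑ i ∈ Finset.range (Γ.diam + 1), c i • act W (F i) v : W) : X → ℂ) =
        (∑ i ∈ Finset.range (Γ.diam + 1), c i • F i) *ᵥ (v : X → ℂ) := by
    intro F hF c v
    rw [AddSubmonoidClass.coe_finsetSum, Matrix.sum_mulVec]
    refine Finset.sum_congr rfl fun i hi => ?_
    rw [Submodule.coe_smul, coe_act (hF i (by simpa [Nat.lt_succ_iff] using hi)),
      Matrix.smul_mulVec]
  have hmul : ∀ (F : ℕ → Matrix X X ℂ) (_ : ∀ i ≤ Γ.diam, ∀ w ∈ W, F i *ᵥ w ∈ W)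
      (_ : ∀ i ≤ Γ.diam, ∀ j ≤ Γ.diam, F i * F j = if i = j then F i else 0),
      ∀ i ≤ Γ.diam, ∀ j ≤ Γ.diam, ∀ v : W,
        act W (F i) (act W (F j) v) = if i = j then act W (F i) v else 0 := by
    intro F hF hFF i hi j hj v
    refine Subtype.ext ?_
    rw [coe_act (hF i hi), coe_act (hF j hj), Matrix.mulVec_mulVec, hFF i hi j hj]
    split_ifs
    · rw [coe_act (hF i hi)]
    · rw [Matrix.zero_mulVec]
      rfl
  constructor
  · intro v
    have := hsum E hEW (fun _ => 1) v
    simp only [one_smul, hE.sum_eq, Matrix.one_mulVec] at this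
    exact Subtype.ext this
  · intro v
    have := hsum _ hEsW (fun _ => 1) v
    simp only [one_smul, sum_dualIdempotent hΓ, Matrix.one_mulVec] at this
    exact Subtype.ext this
  · exact hmul E hEW hE.mul_eq
  · exact hmul _ hEsW fun i _ j _ => dualIdempotent_mul Γ x i j
  · intro v
    refine Subtype.ext ?_
    rw [hsum E hEW, ← hθ, coe_act hA]
  · intro v
    refine Subtype.ext ?_
    rw [hsum _ hEsW, ← hθs, coe_act hAs]
  · intro i hi j hj hij v
    refine Subtype.ext ?_
    rw [coe_act (hEW i hi), coe_act hAs, coe_act (hEW j hj), Matrix.mulVec_mulVec,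
      Matrix.mulVec_mulVec, mul_dualAdjacency_mul hE hQ hD x hi hj hij,
      Matrix.zero_mulVec]
    rfl
  · intro i hi j hj hij v
    refine Subtype.ext ?_
    rw [coe_act (hEsW i hi), coe_act hA, coe_act (hEsW j hj), Matrix.mulVec_mulVec,
      Matrix.mulVec_mulVec, dualIdempotent_mul_adjacency_mul hΓ x hij,
      Matrix.zero_mulVec]
    rfl
  · intro S hS1 hS2
    have hS := hW.2.2 (S.map W.subtype) (isTModule_of_invariant hΓ hE hQ hD ?_ ?_)
      (Submodule.map_subtype_le W S)
    · refine hS.imp (fun h => ?_) fun h => ?_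
      · exact Submodule.map_injective_of_injective W.injective_subtype
          (h.trans (Submodule.map_bot _).symm)
      · refine Submodule.map_injective_of_injective W.injective_subtype ?_
        rw [h, Submodule.map_subtype_top]
    · rintro _ ⟨v, hv, rfl⟩
      exact ⟨_, hS1 v hv, coe_act hA v⟩
    · rintro _ ⟨v, hv, rfl⟩
      exact ⟨_, hS2 v hv, coe_act hAs v⟩

theorem firstSplit_one_eq {θ θs : ℕ → ℂ} {W : Submodule ℂ (X → ℂ)}
    (hA : ∀ w ∈ W, adjacency Γ *ᵥ w ∈ W) (hAs : ∀ w ∈ W, dualAdjacency E x *ᵥ w ∈ W)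
    {r t : ℕ} (hr : r = endpoint Γ x W) (ht : t = dualEndpoint Γ E W)
    (hEs : ∀ w ∈ W, dualIdempotent Γ x r *ᵥ w ∈ W) {φ : ℂ}
    (hφ : ∀ v z : W, z = act W (adjacency Γ) (act W (dualIdempotent Γ x r) v) -
        θ t • act W (dualIdempotent Γ x r) v →
      act W (adjacency Γ) (act W (dualAdjacency E x) z - θs (r + 1) • z) -
        θ t • (act W (dualAdjacency E x) z - θs (r + 1) • z) = φ • z)
    (hne : ∃ v : W, act W (adjacency Γ) (act W (dualIdempotent Γ x r) v) -
        θ t • act W (dualIdempotent Γ x r) v ≠ 0) :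
    firstSplit Γ E θ θs x W 1 = φ := by
  subst hr ht
  set r := endpoint Γ x W
  set t := dualEndpoint Γ E W
  have hpoly : Polynomial.aeval (adjacency Γ) (tauPoly θ t 1) = adjacency Γ - θ t • 1 := by
    rw [tauPoly, Finset.prod_range_one, map_sub, Polynomial.aeval_X, Polynomial.aeval_C,
      Algebra.algebraMap_eq_smul_one, add_zero]
  have hsplit : ∀ v : W, ((act W (adjacency Γ) (act W (dualIdempotent Γ x r) v) -
      θ t • act W (dualIdempotent Γ x r) v : W) : X → ℂ) =
        (adjacency Γ - θ t • 1) *ᵥ (dualIdempotent Γ x r *ᵥ (v : X → ℂ)) := fun v => by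
    rw [Submodule.coe_sub, Submodule.coe_smul, coe_act hA, coe_act hEs, Matrix.sub_mulVec,
      Matrix.smul_mulVec, Matrix.one_mulVec]
  have hop : ∀ z : W, ((adjacency Γ - θ t • 1) * (dualAdjacency E x - θs (r + 1) • 1)) *ᵥ
      (z : X → ℂ) = ((act W (adjacency Γ) (act W (dualAdjacency E x) z - θs (r + 1) • z) -
        θ t • (act W (dualAdjacency E x) z - θs (r + 1) • z) : W) : X → ℂ) := fun z => by
    rw [← Matrix.mulVec_mulVec, Submodule.coe_sub, Submodule.coe_smul, coe_act hA,
      Submodule.coe_sub, Submodule.coe_smul, coe_act hAs, Matrix.sub_mulVec _ (θ t • 1),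
      Matrix.sub_mulVec, Matrix.smul_mulVec, Matrix.smul_mulVec, Matrix.one_mulVec,
      Matrix.one_mulVec]
  have hspec : ∀ u ∈ splitSpace Γ E θ x W 1,
      ((adjacency Γ - θ (t + 1 - 1) • 1) * (dualAdjacency E x - θs (r + 1) • 1)) *ᵥ u =
        firstSplit Γ E θ θs x W 1 • u := Classical.epsilon_spec (p := fun c : ℂ =>
      ∀ u ∈ splitSpace Γ E θ x W 1, ((adjacency Γ - θ (t + 1 - 1) • 1) *
        (dualAdjacency E x - θs (r + 1) • 1)) *ᵥ u = c • u) <| by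
    refine ⟨φ, ?_⟩
    rintro _ ⟨_, ⟨v, hv, rfl⟩, rfl⟩
    rw [hpoly, Nat.add_sub_cancel]
    have h1 := hsplit ⟨v, hv⟩
    simp only [Matrix.mulVecLin_apply]
    rw [← h1, hop, hφ ⟨v, hv⟩ _ rfl, Submodule.coe_smul]
  obtain ⟨v, hv⟩ := hne
  have hmem : ((act W (adjacency Γ) (act W (dualIdempotent Γ x r) v) -
      θ t • act W (dualIdempotent Γ x r) v : W) : X → ℂ) ∈ splitSpace Γ E θ x W 1 := by
    rw [hsplit, ← hpoly]
    exact ⟨_, ⟨v, v.2, rfl⟩, rfl⟩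
  have h1 := hspec _ hmem
  rw [Nat.add_sub_cancel, hop, hφ v _ rfl] at h1
  -- A nonzero vector of the split space determines the eigenvalue chosen in `firstSplit`.
  exact (smul_left_injective ℂ hv (Subtype.ext h1)).symm

end Module

end Terwilliger

/-! ### Assembly of the formulas and their duals. -/

theorem mainTheorem10 {X : Type*} [Fintype X] [DecidableEq X]
    (Γ : SimpleGraph X) (hΓ : IsDistanceRegular Γ) (hD : 3 ≤ Γ.diam)
    (hk : ∀ y : X, 3 ≤ (Γ.neighborSet y).ncard)
    (E : ℕ → Matrix X X ℂ) (hE : IsPrimitiveIdempotents Γ E) (hQ : IsQPolynomial Γ E)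
    (x : X) (θ θs : ℕ → ℂ)
    (hθ : adjacency Γ = ∑ i ∈ Finset.range (Γ.diam + 1), θ i • E i)
    (hθs : dualAdjacency E x = ∑ i ∈ Finset.range (Γ.diam + 1), θs i • dualIdempotent Γ x i)
    (W : Submodule ℂ (X → ℂ)) (hW : IsIrreducibleTModule Γ x W) (hthin : IsThin Γ x W)
    (r t d : ℕ) (hr : r = endpoint Γ x W) (ht : t = dualEndpoint Γ E W)
    (hd : d = moduleDiameter Γ x W) (hd1 : 1 ≤ d)
    (φ₁ : ℂ) (hφ : φ₁ = firstSplit Γ E θ θs x W 1) :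
    -- the intersection numbers
    (bNum Γ E x W 0 = φ₁ / (θs (r + 1) - θs r) ∧
      (∀ i : ℕ, 1 ≤ i → i ≤ d - 1 →
        bNum Γ E x W i =
          (φ₁ * fPlus (shift θs r) d i + gPlus (shift θ t) (shift θs r) d i) /
            ((θs (r + i + 1) - θs (r + i)) * (θs (r + i + 1) - θs (r + i - 1)))) ∧
      (∀ i : ℕ, 1 ≤ i → i ≤ d - 1 →
        cNum Γ E x W i =
          (φ₁ * fMinus (shift θs r) d i + gMinus (shift θ t) (shift θs r) d i) /
            ((θs (r + i - 1) - θs (r + i)) * (θs (r + i - 1) - θs (r + i + 1)))) ∧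
      cNum Γ E x W d =
        (φ₁ + (θ (t + 1) - θ t) * (θs (r + d) - θs r)) / (θs (r + d - 1) - θs (r + d))) ∧
    -- the dual intersection numbers
    (bNumDual Γ E x W 0 = φ₁ / (θ (t + 1) - θ t) ∧
      (∀ i : ℕ, 1 ≤ i → i ≤ d - 1 →
        bNumDual Γ E x W i =
          (φ₁ * fPlus (shift θ t) d i + gPlus (shift θs r) (shift θ t) d i) /
            ((θ (t + i + 1) - θ (t + i)) * (θ (t + i + 1) - θ (t + i - 1)))) ∧
      (∀ i : ℕ, 1 ≤ i → i ≤ d - 1 →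
        cNumDual Γ E x W i =
          (φ₁ * fMinus (shift θ t) d i + gMinus (shift θs r) (shift θ t) d i) /
            ((θ (t + i - 1) - θ (t + i)) * (θ (t + i - 1) - θ (t + i + 1)))) ∧
      cNumDual Γ E x W d =
        (φ₁ + (θs (r + 1) - θs r) * (θ (t + d) - θ t)) / (θ (t + d - 1) - θ (t + d))) := by
  have hD1 : 1 ≤ Γ.diam := by omega
  have hAT : adjacency Γ ∈ boseMesner Γ := Submodule.subset_span ⟨⟨1, by omega⟩, rfl⟩
  have hA : ∀ w ∈ W, adjacency Γ *ᵥ w ∈ W :=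
    hW.1 _ (mem_terwilligerAlgebra_of_mem_boseMesner hAT)
  have hAs : ∀ w ∈ W, dualAdjacency E x *ᵥ w ∈ W := by
    refine hW.1 _ ?_
    rw [hθs]
    refine Subalgebra.sum_mem _ fun i hi => Subalgebra.smul_mem _
      (dualIdempotent_mem_terwilligerAlgebra (by simpa [Nat.lt_succ_iff] using hi)) _
  have hEW : ∀ i ≤ Γ.diam, ∀ w ∈ W, E i *ᵥ w ∈ W := fun i hi =>
    hW.1 _ (mem_terwilligerAlgebra_of_mem_boseMesner (hE.mem_boseMesner hi))
  have hEsW : ∀ i ≤ Γ.diam, ∀ w ∈ W, dualIdempotent Γ x i *ᵥ w ∈ W := fun i hi =>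
    hW.1 _ (dualIdempotent_mem_terwilligerAlgebra hi)
  have h := tdSystem hΓ hD1 hE hQ hθ hθs hW hA hAs hEW hEsW
  have hQr : RankLeOne Γ.diam fun i => act W (dualIdempotent Γ x i) := fun i hi v w =>
    exists_act_eq_smul (hEsW i hi) (hthin i hi) v w
  have hS := act_ne_zero_iff_mem_interval h hEsW hW.2.1
  have hSd := act_ne_zero_iff_mem_interval h.swap hEW hW.2.1
  obtain ⟨e, he⟩ : ∃ e, e = {i : ℕ | i ≤ Γ.diam ∧ image (E i) W ≠ ⊥}.ncard - 1 := ⟨_, rfl⟩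
  have ht' := ht
  have hr' := hr
  have hd' := hd
  rw [dualEndpoint] at ht'
  rw [endpoint] at hr'
  rw [moduleDiameter] at hd'
  simp only [← hr', ← hd'] at hS
  simp only [← ht', ← he] at hSd
  clear ht' hr' hd' he
  have hrd : r + d ≤ Γ.diam := ((hS (r + d)).2 ⟨by omega, le_rfl⟩).1
  have hte : t + e ≤ Γ.diam := ((hSd (t + e)).2 ⟨by omega, le_rfl⟩).1
  have hsuppQ : ∀ i ≤ Γ.diam, act W (dualIdempotent Γ x i) ≠ 0 ↔ r ≤ i ∧ i ≤ r + d :=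
    fun i hi => by rw [← hS, and_iff_right hi]
  have hsuppP : ∀ i ≤ Γ.diam, act W (E i) ≠ 0 ↔ t ≤ i ∧ i ≤ t + e :=
    fun i hi => by rw [← hSd, and_iff_right hi]
  have hQlt : ∀ i < r, act W (dualIdempotent Γ x i) = 0 := fun i hi => by
    by_contra hc
    have := (hsuppQ i (by omega)).1 hc
    omega
  have hPlt : ∀ i < t, act W (E i) = 0 := fun i hi => by
    by_contra hc
    have := (hsuppP i (by omega)).1 hc
    omega
  have hQ0 : act W (dualIdempotent Γ x r) ≠ 0 := (hsuppQ r (by omega)).2 ⟨le_rfl, by omega⟩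
  have hP0 : act W (E t) ≠ 0 := (hsuppP t (by omega)).2 ⟨le_rfl, by omega⟩
  have hPr : RankLeOne Γ.diam fun i => act W (E i) :=
    h.rankLeOne_left hQr (by omega) hQ0 hQlt
  obtain ⟨u, hu, hPu, hM⟩ := exists_epsilon_spec h hQr hPr hA hEW hEsW hrd hsuppQ
    (by omega) hP0 hPlt
  have hune : ∀ i ≤ d, act W (dualIdempotent Γ x (r + i)) u ≠ 0 := fun i hi =>
    h.right_apply_ne_zero hPr (by omega) hPlt hu hPu (by omega)
      ((hsuppQ (r + i) (by omega)).2 ⟨by omega, by omega⟩)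
  have hvne : ∀ v ≠ 0, act W (dualIdempotent Γ x r) v = v → ∀ i ≤ e, act W (E (t + i)) v ≠ 0 :=
    fun v hv hQv i hi => h.swap.right_apply_ne_zero hQr (by omega) hQlt hv hQv (by omega)
      ((hsuppP (t + i) (by omega)).2 ⟨by omega, by omega⟩)
  have hQQ : ∀ v, act W (dualIdempotent Γ x r) (act W (dualIdempotent Γ x r) v) =
      act W (dualIdempotent Γ x r) v := fun v => by
    rw [h.mul_right r (by omega) r (by omega), if_pos rfl]
  have hQu : act W (dualIdempotent Γ x r) u ≠ 0 := hune 0 (by omega)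
  -- Diameter and dual diameter agree because `dim W` equals each of them plus one.
  obtain rfl : e = d := by
    have h1 := h.finrank_eq hQr hrd hsuppQ hune
    have h2 := h.swap.finrank_eq hPr hte hsuppP (hvne _ hQu (hQQ u))
    omega
  obtain ⟨v, hv, hQv, hN⟩ := exists_epsilon_spec h.swap hPr hQr hAs hEsW hEW hte hsuppP
    (by omega) hQ0 hQlt
  have hθne := hE.ne_of_adjacency_eq hΓ hθ
  have hθsne := ne_of_dualAdjacency_eq hΓ hE hQ hD1 hθs
  obtain ⟨κ, hκ⟩ := hPr t (by omega) u (act W (dualAdjacency E x) u) (by simpa only [hPu] using hu)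
  obtain ⟨m, hm⟩ := hQr r (by omega) u (act W (adjacency Γ) (act W (dualIdempotent Γ x r) u)) hQu
  simp only [hPu] at hκ
  have hmv : ∀ v, act W (dualIdempotent Γ x r) (act W (adjacency Γ)
      (act W (dualIdempotent Γ x r) v)) = m • act W (dualIdempotent Γ x r) v := fun v => by
    obtain ⟨c, hc⟩ := hQr r (by omega) u v hQu
    beta_reduce at hc hm
    rw [hc, map_smul, map_smul, hm, smul_comm]
  have hsplit : φ₁ = (θ t - m) * (θs (r + 1) - θs r) := by
    rw [hφ]
    refine firstSplit_one_eq hA hAs hr ht (hEsW r (by omega)) (fun v z hz =>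
      h.split_eigenvalue (by omega) hQlt (hQQ v) (hmv v) hz) ⟨u, fun hz => ?_⟩
    -- If `(A - θ_t) E*_r u` vanished, its nonzero `E_{t+1}`-component would force `θ_{t+1} = θ_t`;
    -- `d ≥ 1` enters here.
    have h1 := congrArg (act W (E (t + 1))) (sub_eq_zero.1 hz)
    have h2 := h.swap.right_apply_right (i := t + 1) (by omega) (act W (dualIdempotent Γ x r) u)
    beta_reduce at h2
    rw [h2, map_smul] at h1
    exact hθne (t + 1) (by omega) t (by omega) (by omega)
      (smul_left_injective ℂ (hvne _ hQu (hQQ u) 1 hd1) h1)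
  have hdual : φ₁ = (θs (r + 1) - θs r) * (θ t - m) := by rw [hsplit, mul_comm]
  have hmain := h.formulas hPr hd1 hrd hsuppQ (by omega) hPlt hθsne hu hPu hM hκ rfl
  have h00 := h.right_apply_left_right hrd hM 0 0
  simp only [Fin.val_zero, add_zero] at h00 hm
  rw [hm] at h00
  -- The two expressions for `b_0`, namely `θ_t - m` from the row sum and the closed form in `κ`,
  -- are compared.
  have hφ' : φ₁ = (θ (t + 1) - θ t) * (θs r - κ) := by
    have h1 := hmain.1.1
    rw [hmain.2, ← smul_left_injective ℂ hQu h00, eq_div_iff (sub_ne_zero.2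
      (hθsne (r + 1) (by omega) r (by omega) (by omega)))] at h1
    rw [hsplit, h1]
  rw [← hφ'] at hmain
  have hkv := hmv v
  rw [hQv] at hkv
  have hmaind := h.swap.formulas hQr hd1 hte hsuppP (by omega) hQlt hθne hv hQv hN hkv hdual
  subst hr ht hd
  exact ⟨hmain.1, hmaind.1⟩
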